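/- Let $M$ be a closed smooth manifold, let $f^\alpha,f^\beta:M\to\mathbb{R}$ be Morse functions and $g^\alpha,g^\beta$ smooth Riemannian metrics on $M$, let $\ell\ge 0$, and let $(H,G)=(H_{[\ell]},G_{[\ell]})$ be a finite homotopy between $(f^\alpha,g^\alpha)$ and $(f^\beta,g^\beta)$ with parameters in $[0,1]^\ell$: $H:[0,1]^\ell\times\mathbb{R}\times M\to\mathbb{R}$ is smooth, $G(\mathbf{s},t)$ is a Riemannian metric on $M$ depending smoothly on $(\mathbf{s},t)\in[0,1]^\ell\times\mathbb{R}$ and on the point of $M$, and there is $T>0$ such that $(H(\mathbf{s},t,\cdot),G(\mathbf{s},t))$ equals $(f^\alpha,g^\alpha)$ for $t<-T$ and $(f^\beta,g^\beta)$ for $t>T$, for every $\mathbf{s}$. For $c,c'\in M$ let $\mathcal{P}^{1,2}_{c,c'}$ be the space of $W^{1,2}$-paths $u:\mathbb{R}\to M$ with $u(t)\to c$ as $t\to-\infty$ and $u(t)\to c'$ as $t\to+\infty$. Put $$\mathcal{M}^{H}_{c,c'}=\{(\mathbf{s},u)\in[0,1]^\ell\times\mathcal{P}^{1,2}_{c,c'}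 : \dot u(t)=-\nabla_{G(\mathbf{s},t)}H(\mathbf{s},t,u(t))\ \text{for all } t\in\mathbb{R}\}$$ with the topology of $[0,1]^\ell\times\mathcal{P}^{1,2}_{c,c'}$. For $(f,g)=(f^\alpha,g^\alpha)$ or $(f^\beta,g^\beta)$, an $f$-trajectory from $c$ to $c'$ is a $u\in\mathcal{P}^{1,2}_{c,c'}$ with $\dot u=-\nabla_g f(u)$. Let $p\in \mathrm{Cr}\,f^\alpha$ and $q\in \mathrm{Cr}\,f^\beta$. A broken gradient flow line from $p$ to $q$ is a tuple $y=\{u^1,\dots,u^{k_0-1},(\mathbf{s}_0,u^{k_0}),u^{k_0+1},\dots,u^n\}$ with $n\ge 2$ and $1\le k_0\le n$, for which there are points $c_0=p,c_1,\dots,c_n=q$ of $M$, with $c_k\in \mathrm{Cr}\,f^\alpha$ for $k<k_0$ and $c_k\in \mathrm{Cr}\,f^\beta$ for $k\ge k_0$, such that $u^k$ is a non-constant $f^\alpha$-trajectory from $c_{k-1}$ to $c_k$ for $k<k_0$, $(\mathbf{s}_0,u^{k_0})\in\mathcal{M}^{H}_{c_{k_0-1},c_{k_0}}$ (where $u^{k_0}$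 may be constant), and $u^k$ is a non-constant $f^\beta$-trajectory from $c_{k-1}$ to $c_k$ for $k>k_0$. A sequence $(\mathbf{s}_j,u_j)$ Floer–Gromov converges to $y$ if $\mathbf{s}_j\to\mathbf{s}_0$ and there are real numbers $r^k_j$, with $r^{k_0}_j=0$ for all $j$, such that $u_j(\cdot+r^k_j)\to u^k$ in $C^\infty_{loc}(\mathbb{R},M)$ as $j\to\infty$ for every $1\le k\le n$. Theorem. Every sequence $(\mathbf{s}_\nu,u_\nu)_\nu$ in $\mathcal{M}^{H}_{p,q}$ has a subsequence $(\mathbf{s}_{\nu_j},u_{\nu_j})_j$ that, if it does not converge in $\mathcal{M}^{H}_{p,q}$, Floer–Gromov converges to a broken gradient flow line from $p$ to $q$. -/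

import Mathlib

open Set Filter Topology MeasureTheory
open scoped Manifold ContDiff ENNReal

noncomputable section

namespace HigherMorse

/-- The model space of an `m`-dimensional manifold. -/
abbrev Model (m : ℕ) : Type := EuclideanSpace ℝ (Fin m)

section Basics

variable {m : ℕ} {M : Type*} [TopologicalSpace M] [ChartedSpace (Model m) M]
  [IsManifold 𝓘(ℝ, Model m) ∞ M]

variable (m M) in
/-- Smooth Riemannian metrics on the manifold `M`. -/
abbrev Metric : Type _ :=
  Bundle.ContMDiffRiemannianMetric 𝓘(ℝ, Model m) ∞ (Model m)
    (fun x : M ↦ TangentSpace 𝓘(ℝ, Model m) x)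

/-- A Riemannian metric identifies covectors with vectors. -/
theorem existsUnique_inner_eq (g : Metric m M) (x : M)
    (L : TangentSpace 𝓘(ℝ, Model m) x →L[ℝ] ℝ) :
    ∃! v : TangentSpace 𝓘(ℝ, Model m) x, ∀ w, g.inner x v w = L w := by
  let B : Model m →ₗ[ℝ] Module.Dual ℝ (Model m) :=
    { toFun := fun v ↦ (g.inner x v).toLinearMap
      map_add' := fun v w ↦ LinearMap.ext fun y ↦
        congrArg (fun L : TangentSpace 𝓘(ℝ, Model m) x →L[ℝ] ℝ ↦ L y) ((g.inner x).map_add v w)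
      map_smul' := fun c v ↦ LinearMap.ext fun y ↦
        congrArg (fun L : TangentSpace 𝓘(ℝ, Model m) x →L[ℝ] ℝ ↦ L y) ((g.inner x).map_smul c v) }
  have hinj : Function.Injective B := by
    rw [injective_iff_map_eq_zero]
    intro v hv
    by_contra hne
    have h1 := g.pos x v hne
    have h2 : g.inner x v v = 0 := LinearMap.congr_fun hv v
    linarith
  have hsurj : Function.Surjective B :=
    (LinearMap.injective_iff_surjective_of_finrank_eq_finrank
      (Subspace.dual_finrank_eq (K := ℝ) (V := Model m)).symm).1 hinj
  obtain ⟨v, hv⟩ := hsurj L.toLinearMap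
  refine ⟨v, fun w ↦ LinearMap.congr_fun hv w, fun v' hv' ↦ hinj ?_⟩
  rw [hv]
  exact LinearMap.ext hv'

/-- The gradient `∇_g f (x)`: the unique tangent vector with `g(∇_g f, w) = df(w)` for all `w`. -/
def gradient (g : Metric m M) (f : M → ℝ) (x : M) : TangentSpace 𝓘(ℝ, Model m) x :=
  (existsUnique_inner_eq g x (mfderiv 𝓘(ℝ, Model m) 𝓘(ℝ, ℝ) f x)).choose

variable (m) in
/-- Critical points of `f`. -/
def IsCritical (f : M → ℝ) (p : M) : Prop :=
  mfderiv 𝓘(ℝ, Model m) 𝓘(ℝ, ℝ) f p = 0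

variable (m) in
/-- The Hessian matrix `∂²f / ∂xᵢ∂xⱼ` at `p`, as a bilinear form, in the preferred chart at `p`. -/
def hessian (f : M → ℝ) (p : M) : Model m →L[ℝ] Model m →L[ℝ] ℝ :=
  fderiv ℝ (fderiv ℝ (f ∘ (extChartAt 𝓘(ℝ, Model m) p).symm)) (extChartAt 𝓘(ℝ, Model m) p p)

variable (m) in
/-- Morse functions: smooth, with non-degenerate Hessian at every critical point. -/
structure IsMorse (f : M → ℝ) : Prop where
  smooth : ContMDiff 𝓘(ℝ, Model m) 𝓘(ℝ, ℝ) ∞ f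
  nondegenerate : ∀ p, IsCritical m f p → ∀ v, (∀ w, hessian m f p v w = 0) → v = 0

/-- Solutions of the (possibly non-autonomous) negative gradient flow equation
`u'(t) = - ∇_{g(t)} h(t, u(t))`, `t ∈ ℝ`. -/
def IsFlowLine (g : ℝ → Metric m M) (h : ℝ → M → ℝ) (u : ℝ → M) : Prop :=
  ∀ t : ℝ, HasMFDerivAt 𝓘(ℝ, ℝ) 𝓘(ℝ, Model m) u t
    ((1 : ℝ →L[ℝ] ℝ).smulRight (-gradient (g t) (h t) (u t)))

variable (m) in
/-- The space `𝒫^{1,2}_{p,q}` of `W^{1,2}`-paths from `p` to `q`.  Sobolev regularity of a path in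
the closed manifold `M` is tested by composing with all smooth functions `φ : M → ℝ` (equivalently,
with the coordinates of an embedding of `M` in a Euclidean space): `φ ∘ u` is the primitive of an
`L²` function, and it differs from its limits `φ p`, `φ q` by an `L²` function at the two ends. -/
structure IsW12Path (p q : M) (u : ℝ → M) : Prop where
  continuous : Continuous u
  tendsto_atBot : Tendsto u atBot (𝓝 p)
  tendsto_atTop : Tendsto u atTop (𝓝 q)
  weakDeriv : ∀ φ : M → ℝ, ContMDiff 𝓘(ℝ, Model m) 𝓘(ℝ, ℝ) ∞ φ →
    ∃ v : ℝ → ℝ, MemLp v 2 volume ∧ ∀ a b : ℝ, φ (u b) - φ (u a) = ∫ t in a..b, v t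
  memLp_atBot : ∀ φ : M → ℝ, ContMDiff 𝓘(ℝ, Model m) 𝓘(ℝ, ℝ) ∞ φ →
    MemLp (fun t ↦ φ (u t) - φ p) 2 (volume.restrict (Iic 0))
  memLp_atTop : ∀ φ : M → ℝ, ContMDiff 𝓘(ℝ, Model m) 𝓘(ℝ, ℝ) ∞ φ →
    MemLp (fun t ↦ φ (u t) - φ q) 2 (volume.restrict (Ici 0))

variable (m) in
/-- Convergence of a sequence of paths in the topology of `𝒫^{1,2}_{p,q}`: for all smooth
`φ : M → ℝ`, the differences `φ ∘ u_ν - φ ∘ w` tend to `0` in `W^{1,2}(ℝ)`.  (For `W^{1,2}`-paths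
`deriv` is, almost everywhere, the weak derivative.) -/
def TendstoW12 (u : ℕ → ℝ → M) (w : ℝ → M) : Prop :=
  ∀ φ : M → ℝ, ContMDiff 𝓘(ℝ, Model m) 𝓘(ℝ, ℝ) ∞ φ →
    Tendsto (fun ν ↦ eLpNorm (fun t ↦ φ (u ν t) - φ (w t)) 2 volume) atTop (𝓝 0) ∧
    Tendsto (fun ν ↦ eLpNorm (fun t ↦ deriv (fun r ↦ φ (u ν r)) t - deriv (fun r ↦ φ (w r)) t)
      2 volume) atTop (𝓝 0)

variable (m) in
/-- `C^∞_loc`-convergence of curves in `M`: uniform convergence on compact intervals of all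
derivatives, tested by composing with all smooth functions `φ : M → ℝ` (equivalently, with the
coordinates of an embedding of `M` in a Euclidean space). -/
def TendstoCinftyLoc (u : ℕ → ℝ → M) (w : ℝ → M) : Prop :=
  ∀ φ : M → ℝ, ContMDiff 𝓘(ℝ, Model m) 𝓘(ℝ, ℝ) ∞ φ → ∀ k : ℕ,
    TendstoLocallyUniformly (fun ν ↦ iteratedDeriv k (fun t ↦ φ (u ν t)))
      (iteratedDeriv k (fun t ↦ φ (w t))) atTop

/-- `W^{1,2}`-flow lines of `(h, g)` from `p` to `q`. -/
def connecting (g : ℝ → Metric m M) (h : ℝ → M → ℝ) (p q : M) : Set (ℝ → M) :=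
  {u | IsW12Path m p q u ∧ IsFlowLine g h u}

/-- Parametrized flow lines of the time-independent pair `(f, g)` from `p` to `q`: the
representatives of the elements of `ℳ^f_{p,q}`. -/
def connectingAutonomous (g : Metric m M) (f : M → ℝ) (p q : M) : Set (ℝ → M) :=
  connecting (fun _ ↦ g) (fun _ ↦ f) p q

end Basics

/-- The parameter cube `[0,1]^ℓ`. -/
def cube (ℓ : ℕ) : Set (Fin ℓ → ℝ) := Icc 0 1

section Homotopy

variable {m ℓ : ℕ} {M : Type*} [TopologicalSpace M] [ChartedSpace (Model m) M]
  [IsManifold 𝓘(ℝ, Model m) ∞ M]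

/-- `(H, G)` is a finite homotopy with parameters in `[0,1]^ℓ` from `(fα, gα)` to `(fβ, gβ)`:
`H` and `G` are smooth on `[0,1]^ℓ × ℝ × M`, and for some `T > 0` they coincide with `(fα, gα)` for
`t < -T` and with `(fβ, gβ)` for `t > T`.  Only the values at parameters in the cube matter. -/
structure IsHomotopy (fα : M → ℝ) (gα : Metric m M) (fβ : M → ℝ) (gβ : Metric m M)
    (H : (Fin ℓ → ℝ) → ℝ → M → ℝ) (G : (Fin ℓ → ℝ) → ℝ → Metric m M) : Prop where
  smooth_fun : ContMDiffOn (𝓘(ℝ, (Fin ℓ → ℝ) × ℝ).prod 𝓘(ℝ, Model m)) 𝓘(ℝ, ℝ) ∞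
    (fun z : ((Fin ℓ → ℝ) × ℝ) × M ↦ H z.1.1 z.1.2 z.2) ((cube ℓ ×ˢ univ) ×ˢ univ)
  smooth_metric : ContMDiffOn (𝓘(ℝ, (Fin ℓ → ℝ) × ℝ).prod 𝓘(ℝ, Model m))
    (𝓘(ℝ, Model m).prod 𝓘(ℝ, Model m →L[ℝ] Model m →L[ℝ] ℝ)) ∞
    (fun z : ((Fin ℓ → ℝ) × ℝ) × M ↦
      Bundle.TotalSpace.mk' (Model m →L[ℝ] Model m →L[ℝ] ℝ)
        (E := fun x : M ↦ TangentSpace 𝓘(ℝ, Model m) x →L[ℝ]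
          TangentSpace 𝓘(ℝ, Model m) x →L[ℝ] ℝ)
        z.2 ((G z.1.1 z.1.2).inner z.2))
    ((cube ℓ ×ˢ univ) ×ˢ univ)
  finite : ∃ T : ℝ, 0 < T ∧ ∀ s ∈ cube ℓ,
    (∀ t < -T, H s t = fα ∧ G s t = gα) ∧ (∀ t > T, H s t = fβ ∧ G s t = gβ)

/-- The moduli space `ℳ^H_{p,q}` of pairs `(s, u)` with `s ∈ [0,1]^ℓ` and `u ∈ 𝒫^{1,2}_{p,q}` a flow
line of `(H(s, ·, ·), G(s, ·))`. -/
def moduli (H : (Fin ℓ → ℝ) → ℝ → M → ℝ) (G : (Fin ℓ → ℝ) → ℝ → Metric m M) (p q : M) :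
    Set ((Fin ℓ → ℝ) × (ℝ → M)) :=
  {z | z.1 ∈ cube ℓ ∧ z.2 ∈ connecting (G z.1) (H z.1) p q}

/-- The sequence `z` converges in `ℳ^H_{p,q} ⊆ [0,1]^ℓ × 𝒫^{1,2}_{p,q}`. -/
def ConvergesInModuli (H : (Fin ℓ → ℝ) → ℝ → M → ℝ) (G : (Fin ℓ → ℝ) → ℝ → Metric m M) (p q : M)
    (z : ℕ → (Fin ℓ → ℝ) × (ℝ → M)) : Prop :=
  ∃ z₀ ∈ moduli H G p q, Tendsto (fun ν ↦ (z ν).1) atTop (𝓝 z₀.1) ∧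
    TendstoW12 m (fun ν ↦ (z ν).2) z₀.2

/-- Broken flow lines `{u¹, …, (s₀, u^{k₀}), …, uⁿ}`, `n ≥ 2`, from `p` to `q`, with breaking points
`c₀ = p, c₁, …, cₙ = q`.  With the indices of `Fin n` starting at `0`, the piece `u k` runs from
`c k` to `c (k + 1)`.  The trajectories of `fα` and `fβ` are non-constant.  The `H`-trajectory
may be constant: if `(H, G)` is independent of `t`, then the shifts `u(· + ν)` of one flow line
converge in `C^∞_loc` to a constant one. -/
structure BrokenLine (fα : M → ℝ) (gα : Metric m M) (fβ : M → ℝ) (gβ : Metric m M)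
    (H : (Fin ℓ → ℝ) → ℝ → M → ℝ) (G : (Fin ℓ → ℝ) → ℝ → Metric m M) (p q : M) where
  n : ℕ
  two_le : 2 ≤ n
  k₀ : Fin n
  s₀ : Fin ℓ → ℝ
  u : Fin n → ℝ → M
  c : Fin (n + 1) → M
  c_zero : c 0 = p
  c_last : c (Fin.last n) = q
  critical_left : ∀ i : Fin (n + 1), i ≤ k₀.castSucc → IsCritical m fα (c i)
  critical_right : ∀ i : Fin (n + 1), k₀.succ ≤ i → IsCritical m fβ (c i)
  mem_left : ∀ k < k₀, u k ∈ connectingAutonomous gα fα (c k.castSucc) (c k.succ)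
  mem_middle : (s₀, u k₀) ∈ moduli H G (c k₀.castSucc) (c k₀.succ)
  mem_right : ∀ k > k₀, u k ∈ connectingAutonomous gβ fβ (c k.castSucc) (c k.succ)
  nonconstant : ∀ k ≠ k₀, ∀ x : M, u k ≠ fun _ ↦ x

/-- Floer–Gromov convergence of `z ν = (s_ν, u_ν)` to a broken line: `s_ν → s₀`, and there are time
shifts `r k ν`, zero for `k = k₀`, with `u_ν (· + r k ν) → u k` in `C^∞_loc` for every `k`. -/
def FloerGromovTendsto {fα : M → ℝ} {gα : Metric m M} {fβ : M → ℝ} {gβ : Metric m M}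
    {H : (Fin ℓ → ℝ) → ℝ → M → ℝ} {G : (Fin ℓ → ℝ) → ℝ → Metric m M} {p q : M}
    (z : ℕ → (Fin ℓ → ℝ) × (ℝ → M)) (y : BrokenLine fα gα fβ gβ H G p q) : Prop :=
  Tendsto (fun ν ↦ (z ν).1) atTop (𝓝 y.s₀) ∧
  ∃ r : Fin y.n → ℕ → ℝ, (∀ ν, r y.k₀ ν = 0) ∧
    ∀ k, TendstoCinftyLoc m (fun ν t ↦ (z ν).2 (t + r k ν)) (y.u k)

end Homotopy

end HigherMorse

end

/-!
Write the negative gradient equation as a smooth vector field depending on `(s, t)`. The field is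
bounded, because it is independent of `t` near both ends, so flow lines are equi-Lipschitz and by
Arzelà–Ascoli a subsequence converges locally uniformly; the equation passes to the limit and
upgrades the convergence to `C^∞_loc`. The limit of the middle piece tends to critical points at
both ends, since its energy is finite and critical points of a Morse function are isolated.

If the `u_ν` stay near the limit `c` of this piece after a fixed time, the convergence at that end
is in `W^{1,2}`: near a nondegenerate critical point `(φ - φ c)² ≤ C |∇f|²`, and the energy of the
tail is a drop of `f`. Otherwise the first exit times from a neighbourhood of `c` tend to infinity,
and shifting by them yields a non-constant trajectory that starts at `c` and ends at a critical
point of smaller value. As there are finitely many critical points, this stops after finitely many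
steps. The negative end is the positive end of the reversed curves, which flow along `-fα`.
-/

namespace HigherMorse

section Gradient

theorem isInvertible_of_forall_pos {E : Type*} [NormedAddCommGroup E] [NormedSpace ℝ E]
    [FiniteDimensional ℝ E] {B : E →L[ℝ] E →L[ℝ] ℝ} (hB : ∀ v ≠ 0, 0 < B v v) :
    B.IsInvertible := by
  have hinj : Function.Injective B.toLinearMap := by
    rw [injective_iff_map_eq_zero]
    intro v hv
    by_contra hne
    have hvv : B v v = 0 := congrArg (fun L : E →L[ℝ] ℝ ↦ L v) hv
    exact (hB v hne).ne' hvv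
  have hrank : Module.finrank ℝ E = Module.finrank ℝ (E →L[ℝ] ℝ) := by
    rw [LinearMap.toContinuousLinearMap.symm.finrank_eq]
    exact Subspace.dual_finrank_eq.symm
  exact ⟨(LinearEquiv.ofInjectiveOfFinrankEq B.toLinearMap hinj hrank).toContinuousLinearEquiv,
    rfl⟩

variable {m : ℕ} {M : Type*} [TopologicalSpace M] [ChartedSpace (Model m) M]
  [IsManifold 𝓘(ℝ, Model m) ∞ M]

theorem inner_gradient (g : Metric m M) (f : M → ℝ) (x : M)
    (w : TangentSpace 𝓘(ℝ, Model m) x) :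
    g.inner x (gradient g f x) w = mfderiv 𝓘(ℝ, Model m) 𝓘(ℝ, ℝ) f x w :=
  (existsUnique_inner_eq g x (mfderiv 𝓘(ℝ, Model m) 𝓘(ℝ, ℝ) f x)).choose_spec.1 w

theorem eq_gradient (g : Metric m M) (f : M → ℝ) (x : M) (v : TangentSpace 𝓘(ℝ, Model m) x)
    (h : ∀ w, g.inner x v w = mfderiv 𝓘(ℝ, Model m) 𝓘(ℝ, ℝ) f x w) : v = gradient g f x :=
  (existsUnique_inner_eq g x (mfderiv 𝓘(ℝ, Model m) 𝓘(ℝ, ℝ) f x)).choose_spec.2 v h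

theorem gradient_neg (g : Metric m M) (f : M → ℝ) (x : M) :
    gradient g (-f) x = -gradient g f x := by
  refine (eq_gradient g (-f) x _ fun w ↦ ?_).symm
  rw [map_neg, show mfderiv 𝓘(ℝ, Model m) 𝓘(ℝ, ℝ) (-f) x =
    -mfderiv 𝓘(ℝ, Model m) 𝓘(ℝ, ℝ) f x from mfderiv_neg]
  exact congrArg Neg.neg (inner_gradient g f x w)

theorem inCoordinates_bilin_apply {c x : M}
    (hx : x ∈ (trivializationAt (Model m) (TangentSpace 𝓘(ℝ, Model m)) c).baseSet)
    (b : TangentSpace 𝓘(ℝ, Model m) x →L[ℝ] TangentSpace 𝓘(ℝ, Model m) x →L[ℝ] ℝ)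
    (v w : Model m) :
    ContinuousLinearMap.inCoordinates (Model m) (TangentSpace 𝓘(ℝ, Model m) : M → Type _)
        (Model m →L[ℝ] ℝ) (fun x : M ↦ TangentSpace 𝓘(ℝ, Model m) x →L[ℝ] ℝ) c x c x b v w =
      b ((trivializationAt (Model m) (TangentSpace 𝓘(ℝ, Model m)) c).symm x v)
        ((trivializationAt (Model m) (TangentSpace 𝓘(ℝ, Model m)) c).symm x w) := by
  refine (inCoordinates_apply_eq₂ (E₃ := fun _ : M ↦ ℝ) (F₃ := ℝ) hx hx (mem_univ _)).trans ?_
  simp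

theorem inTangentCoordinates_mfderiv_apply {Q : Type*} {F : Q → M → ℝ} {z₀ z : Q × M}
    (hz : z.2 ∈ (trivializationAt (Model m) (TangentSpace 𝓘(ℝ, Model m)) z₀.2).baseSet)
    (w : Model m) :
    inTangentCoordinates 𝓘(ℝ, Model m) 𝓘(ℝ, ℝ) (fun z : Q × M ↦ z.2) (fun z ↦ F z.1 z.2)
        (fun z ↦ mfderiv 𝓘(ℝ, Model m) 𝓘(ℝ, ℝ) (F z.1) z.2) z₀ z w =
      mfderiv 𝓘(ℝ, Model m) 𝓘(ℝ, ℝ) (F z.1) z.2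
        ((trivializationAt (Model m) (TangentSpace 𝓘(ℝ, Model m)) z₀.2).symm z.2 w) := by
  have hy : F z.1 z.2 ∈
      (trivializationAt ℝ (TangentSpace 𝓘(ℝ, ℝ)) (F z₀.1 z₀.2)).baseSet := by
    simp [chartAt_self_eq]
  simp only [inTangentCoordinates]
  rw [ContinuousLinearMap.inCoordinates_eq hz hy]
  simp only [ContinuousLinearMap.comp_apply, ContinuousLinearEquiv.coe_coe,
    Bundle.Trivialization.continuousLinearEquivAt_symm_apply,
    Bundle.Trivialization.continuousLinearEquivAt_apply, trivializationAt_model_space_apply]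
  rfl

variable {Q : Type*} [NormedAddCommGroup Q] [NormedSpace ℝ Q] {B : Set Q}

/-- `g` is a smooth family of metrics over the parameters in `B`: the map `(q, x) ↦ g q x` is a
smooth section over `B × M` of the pulled back bundle of bilinear forms. -/
def IsSmoothMetricOn (g : Q → Metric m M) (B : Set Q) : Prop :=
  ContMDiffOn (𝓘(ℝ, Q).prod 𝓘(ℝ, Model m))
    (𝓘(ℝ, Model m).prod 𝓘(ℝ, Model m →L[ℝ] Model m →L[ℝ] ℝ)) ∞
    (fun z : Q × M ↦ Bundle.TotalSpace.mk' (Model m →L[ℝ] Model m →L[ℝ] ℝ)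
      (E := fun x : M ↦ TangentSpace 𝓘(ℝ, Model m) x →L[ℝ] TangentSpace 𝓘(ℝ, Model m) x →L[ℝ] ℝ)
      z.2 ((g z.1).inner z.2)) (B ×ˢ univ)

theorem contMDiffWithinAt_inTangentCoordinates_mfderiv {F : Q → M → ℝ}
    (hF : ContMDiffOn (𝓘(ℝ, Q).prod 𝓘(ℝ, Model m)) 𝓘(ℝ, ℝ) ∞ (fun z : Q × M ↦ F z.1 z.2)
      (B ×ˢ univ)) {z₀ : Q × M} (hz₀ : z₀ ∈ B ×ˢ (univ : Set M)) :
    ContMDiffWithinAt (𝓘(ℝ, Q).prod 𝓘(ℝ, Model m)) 𝓘(ℝ, Model m →L[ℝ] ℝ) ∞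
      (inTangentCoordinates 𝓘(ℝ, Model m) 𝓘(ℝ, ℝ) (fun z : Q × M ↦ z.2) (fun z ↦ F z.1 z.2)
        (fun z ↦ mfderiv 𝓘(ℝ, Model m) 𝓘(ℝ, ℝ) (F z.1) z.2) z₀) (B ×ˢ univ) z₀ := by
  have hcomp : ContMDiffWithinAt ((𝓘(ℝ, Q).prod 𝓘(ℝ, Model m)).prod 𝓘(ℝ, Model m)) 𝓘(ℝ, ℝ) ∞
      (fun w : (Q × M) × M ↦ F w.1.1 w.2) ((B ×ˢ univ) ×ˢ univ) (z₀, z₀.2) :=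
    (hF (z₀.1, z₀.2) hz₀).comp (z₀, z₀.2) (f := fun w : (Q × M) × M ↦ (w.1.1, w.2))
      ((contMDiff_fst.comp contMDiff_fst).prodMk contMDiff_snd).contMDiffAt.contMDiffWithinAt
      fun w hw ↦ ⟨hw.1.1, mem_univ _⟩
  simpa only [mfderivWithin_univ] using ContMDiffWithinAt.mfderivWithin (N := Q × M)
    (f := fun z x ↦ F z.1 x) (u := univ) (n := ∞) (m := ∞) hcomp contMDiffWithinAt_snd hz₀
    (mapsTo_univ _ _) (by simp) uniqueMDiffOn_univ

/-- In a trivialisation the metric is an invertible matrix `a` and the differential a covector `b`,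
both smooth; the gradient is `a⁻¹ b`. -/
theorem contMDiffOn_gradient {F : Q → M → ℝ} {g : Q → Metric m M}
    (hF : ContMDiffOn (𝓘(ℝ, Q).prod 𝓘(ℝ, Model m)) 𝓘(ℝ, ℝ) ∞ (fun z : Q × M ↦ F z.1 z.2)
      (B ×ˢ univ)) (hg : IsSmoothMetricOn g B) :
    ContMDiffOn (𝓘(ℝ, Q).prod 𝓘(ℝ, Model m)) 𝓘(ℝ, Model m).tangent ∞
      (fun z : Q × M ↦ (⟨z.2, gradient (g z.1) (F z.1) z.2⟩ : TangentBundle 𝓘(ℝ, Model m) M))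
      (B ×ˢ univ) := by
  intro z₀ hz₀
  set e := trivializationAt (Model m) (TangentSpace 𝓘(ℝ, Model m) : M → Type _) z₀.2
  have ha := ((contMDiffWithinAt_hom_bundle _).1 (hg z₀ hz₀)).2
  have hb := contMDiffWithinAt_inTangentCoordinates_mfderiv hF hz₀
  set a : Q × M → Model m →L[ℝ] Model m →L[ℝ] ℝ := fun z ↦ _
  change ContMDiffWithinAt _ _ _ a _ _ at ha
  set b : Q × M → Model m →L[ℝ] ℝ := inTangentCoordinates 𝓘(ℝ, Model m) 𝓘(ℝ, ℝ)
    (fun z : Q × M ↦ z.2) (fun z ↦ F z.1 z.2) (fun z ↦ mfderiv 𝓘(ℝ, Model m) 𝓘(ℝ, ℝ) (F z.1) z.2) z₀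
  have ha_apply : ∀ z : Q × M, z.2 ∈ e.baseSet → ∀ v w,
      a z v w = (g z.1).inner z.2 (e.symm z.2 v) (e.symm z.2 w) :=
    fun z hz ↦ inCoordinates_bilin_apply hz _
  have ha_inv : ∀ z : Q × M, z.2 ∈ e.baseSet → (a z).IsInvertible := fun z hz ↦
    isInvertible_of_forall_pos fun v hv ↦ by
      rw [ha_apply z hz]
      exact (g z.1).pos _ _ (mt (e.continuousLinearEquivAt ℝ z.2 hz).symm.map_eq_zero_iff.1 hv)
  have hgrad : ∀ z : Q × M, z.2 ∈ e.baseSet →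
      (e ⟨z.2, gradient (g z.1) (F z.1) z.2⟩).2 = (a z).inverse (b z) := fun z hz ↦ by
    have hab : a z (e ⟨z.2, gradient (g z.1) (F z.1) z.2⟩).2 = b z := by
      ext w
      rw [ha_apply z hz, inTangentCoordinates_mfderiv_apply hz, ← inner_gradient (g z.1)]
      congr 2
      exact e.symm_apply_apply_mk hz _
    obtain ⟨L, hL⟩ := ha_inv z hz
    rw [← hab, ← hL, ContinuousLinearMap.inverse_equiv]
    exact (L.symm_apply_apply _).symm
  have hz₀e : z₀.2 ∈ e.baseSet := FiberBundle.mem_baseSet_trivializationAt' z₀.2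
  have hbase : ∀ᶠ z in 𝓝[B ×ˢ univ] z₀, z.2 ∈ e.baseSet :=
    continuousWithinAt_snd (e.open_baseSet.mem_nhds hz₀e)
  refine Bundle.contMDiffWithinAt_totalSpace.2 ⟨contMDiffWithinAt_snd, ?_⟩
  refine ContMDiffWithinAt.congr_of_eventuallyEq (f := fun z ↦ (a z).inverse (b z)) ?_
    (hbase.mono hgrad) (hgrad z₀ hz₀e)
  exact (((ha_inv z₀ hz₀e).contDiffAt_map_inverse (n := ∞)).contMDiffAt.comp_contMDiffWithinAt
    z₀ ha).clm_apply hb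

end Gradient

section VectorField

variable {m : ℕ} {M : Type*} [TopologicalSpace M] [ChartedSpace (Model m) M]

/-- `u` solves `u' = Y(·, u)` at time `t`, for a time-dependent vector field `Y`. -/
def IsTrajectoryAt (Y : ℝ → (x : M) → TangentSpace 𝓘(ℝ, Model m) x) (u : ℝ → M) (t : ℝ) : Prop :=
  HasMFDerivAt 𝓘(ℝ, ℝ) 𝓘(ℝ, Model m) u t ((1 : ℝ →L[ℝ] ℝ).smulRight (Y t (u t)))

variable {P : Type*} [NormedAddCommGroup P] [NormedSpace ℝ P] {A : Set P}
  {X : P → ℝ → (x : M) → TangentSpace 𝓘(ℝ, Model m) x} {ψ : (P × ℝ) × M → ℝ} {φ : M → ℝ}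
  {s : P} {u : ℝ → M} {t : ℝ}

/-- The derivative of a function on `A × ℝ × M` along the flow of the family `X` of time-dependent
vector fields, i.e. in the direction `(0, 1, X)`. -/
noncomputable def lieDeriv (X : P → ℝ → (x : M) → TangentSpace 𝓘(ℝ, Model m) x) (A : Set P)
    (ψ : (P × ℝ) × M → ℝ) (z : (P × ℝ) × M) : ℝ :=
  mfderivWithin (𝓘(ℝ, P × ℝ).prod 𝓘(ℝ, Model m)) 𝓘(ℝ, ℝ) ψ ((A ×ˢ univ) ×ˢ univ) z
    (((0, 1) : P × ℝ), X z.1.1 z.1.2 z.2)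

/-- The `k`-fold derivative along the flow of `X` of a function on `M`. -/
noncomputable def flowDeriv (X : P → ℝ → (x : M) → TangentSpace 𝓘(ℝ, Model m) x) (A : Set P)
    (φ : M → ℝ) (k : ℕ) : (P × ℝ) × M → ℝ :=
  (lieDeriv X A)^[k] fun z ↦ φ z.2

theorem flowDeriv_succ (X : P → ℝ → (x : M) → TangentSpace 𝓘(ℝ, Model m) x) (A : Set P)
    (φ : M → ℝ) (k : ℕ) : flowDeriv X A φ (k + 1) = lieDeriv X A (flowDeriv X A φ k) :=
  Function.iterate_succ_apply' _ _ _

theorem IsTrajectoryAt.hasDerivAt (hu : IsTrajectoryAt (X s) u t) (hs : s ∈ A)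
    (hψ : MDifferentiableWithinAt (𝓘(ℝ, P × ℝ).prod 𝓘(ℝ, Model m)) 𝓘(ℝ, ℝ) ψ
      ((A ×ˢ univ) ×ˢ univ) ((s, t), u t)) :
    HasDerivAt (fun τ ↦ ψ ((s, τ), u τ)) (lieDeriv X A ψ ((s, t), u t)) t := by
  have hparam : HasMFDerivAt 𝓘(ℝ, ℝ) 𝓘(ℝ, P × ℝ) (fun τ : ℝ ↦ (s, τ)) t
      ((1 : ℝ →L[ℝ] ℝ).smulRight ((0, 1) : P × ℝ)) :=
    ((hasDerivAt_const t s).prodMk (hasDerivAt_id t)).hasFDerivAt.hasMFDerivAt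
  have hmaps : univ ⊆ (fun τ ↦ ((s, τ), u τ)) ⁻¹' ((A ×ˢ univ) ×ˢ univ) :=
    fun τ _ ↦ ⟨⟨hs, mem_univ _⟩, mem_univ _⟩
  have hcomp := HasMFDerivWithinAt.comp (s := univ) t hψ.hasMFDerivWithinAt
    (hparam.prodMk hu).hasMFDerivWithinAt hmaps
  rw [hasMFDerivWithinAt_univ, hasMFDerivAt_iff_hasFDerivAt] at hcomp
  rw [hasDerivAt_iff_hasFDerivAt]
  refine HasFDerivAt.congr_fderiv hcomp (ContinuousLinearMap.ext_ring ?_)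
  change mfderivWithin (𝓘(ℝ, P × ℝ).prod 𝓘(ℝ, Model m)) 𝓘(ℝ, ℝ) ψ _ ((s, t), u t)
    ((1 : ℝ) • ((0, 1) : P × ℝ), (1 : ℝ) • X s t (u t)) = (1 : ℝ) • lieDeriv X A ψ ((s, t), u t)
  rw [one_smul, one_smul, one_smul]
  rfl

theorem IsTrajectoryAt.hasDerivAt_comp {Y : ℝ → (x : M) → TangentSpace 𝓘(ℝ, Model m) x}
    (hu : IsTrajectoryAt Y u t) (hφ : MDifferentiableAt 𝓘(ℝ, Model m) 𝓘(ℝ, ℝ) φ (u t)) :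
    HasDerivAt (fun τ ↦ φ (u τ)) (mfderiv 𝓘(ℝ, Model m) 𝓘(ℝ, ℝ) φ (u t) (Y t (u t))) t := by
  have hcomp := hφ.hasMFDerivAt.comp t hu
  rw [hasMFDerivAt_iff_hasFDerivAt] at hcomp
  refine hasDerivAt_iff_hasFDerivAt.2
    (HasFDerivAt.congr_fderiv hcomp (ContinuousLinearMap.ext_ring ?_))
  change mfderiv 𝓘(ℝ, Model m) 𝓘(ℝ, ℝ) φ (u t) ((1 : ℝ) • Y t (u t)) =
    (1 : ℝ) • mfderiv 𝓘(ℝ, Model m) 𝓘(ℝ, ℝ) φ (u t) (Y t (u t))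
  rw [one_smul, one_smul]

theorem uniqueMDiffOn_prod_univ (hA : UniqueDiffOn ℝ A) :
    UniqueMDiffOn (𝓘(ℝ, P × ℝ).prod 𝓘(ℝ, Model m))
      ((A ×ˢ univ) ×ˢ univ : Set ((P × ℝ) × M)) :=
  (hA.prod uniqueDiffOn_univ).uniqueMDiffOn.prod uniqueMDiffOn_univ

theorem flowDeriv_one (hA : UniqueDiffOn ℝ A) (hφ : MDifferentiable 𝓘(ℝ, Model m) 𝓘(ℝ, ℝ) φ)
    {z : (P × ℝ) × M} (hz : z.1.1 ∈ A) :
    flowDeriv X A φ 1 z =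
      mfderiv 𝓘(ℝ, Model m) 𝓘(ℝ, ℝ) φ z.2 (X z.1.1 z.1.2 z.2) := by
  have hcomp : HasMFDerivAt (𝓘(ℝ, P × ℝ).prod 𝓘(ℝ, Model m)) 𝓘(ℝ, ℝ)
      (fun z : (P × ℝ) × M ↦ φ z.2) z _ :=
    (hφ z.2).hasMFDerivAt.comp z (hasMFDerivAt_snd z)
  change mfderivWithin _ _ (fun z : (P × ℝ) × M ↦ φ z.2) _ z _ = _
  rw [hcomp.hasMFDerivWithinAt.mfderivWithin
    (uniqueMDiffOn_prod_univ hA z ⟨⟨hz, mem_univ _⟩, mem_univ _⟩)]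
  rfl

variable [IsManifold 𝓘(ℝ, Model m) ∞ M]

/-- `X` is smooth on `A × ℝ × M`: the total map `(s, t, x) ↦ X s t x ∈ TM` is. -/
def IsSmoothFieldOn (X : P → ℝ → (x : M) → TangentSpace 𝓘(ℝ, Model m) x) (A : Set P) : Prop :=
  ContMDiffOn (𝓘(ℝ, P × ℝ).prod 𝓘(ℝ, Model m)) 𝓘(ℝ, Model m).tangent ∞
    (fun z : (P × ℝ) × M ↦ (⟨z.2, X z.1.1 z.1.2 z.2⟩ : TangentBundle 𝓘(ℝ, Model m) M))
    ((A ×ˢ univ) ×ˢ univ)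

theorem IsSmoothFieldOn.contMDiffOn_lieDeriv (hX : IsSmoothFieldOn X A) (hA : UniqueDiffOn ℝ A)
    (hψ : ContMDiffOn (𝓘(ℝ, P × ℝ).prod 𝓘(ℝ, Model m)) 𝓘(ℝ, ℝ) ∞ ψ ((A ×ˢ univ) ×ˢ univ)) :
    ContMDiffOn (𝓘(ℝ, P × ℝ).prod 𝓘(ℝ, Model m)) 𝓘(ℝ, ℝ) ∞ (lieDeriv X A ψ)
      ((A ×ˢ univ) ×ˢ univ) := by
  have htime : ContMDiff 𝓘(ℝ, P × ℝ) 𝓘(ℝ, P × ℝ).tangent ∞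
      (fun y : P × ℝ ↦ (⟨y, ((0, 1) : P × ℝ)⟩ : TangentBundle 𝓘(ℝ, P × ℝ) (P × ℝ))) :=
    contMDiff_vectorSpace_iff_contDiff.2 contDiff_const
  have hdir : ContMDiffOn (𝓘(ℝ, P × ℝ).prod 𝓘(ℝ, Model m))
      (𝓘(ℝ, P × ℝ).prod 𝓘(ℝ, Model m)).tangent ∞
      (fun z : (P × ℝ) × M ↦ (⟨z, (((0, 1) : P × ℝ), X z.1.1 z.1.2 z.2)⟩ :
        TangentBundle (𝓘(ℝ, P × ℝ).prod 𝓘(ℝ, Model m)) ((P × ℝ) × M)))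
      ((A ×ˢ univ) ×ˢ univ) :=
    (contMDiff_equivTangentBundleProd_symm (n := ∞)).comp_contMDiffOn
      ((htime.comp contMDiff_fst).contMDiffOn.prodMk hX)
  exact (contMDiff_snd_tangentBundle_modelSpace ℝ 𝓘(ℝ, ℝ)).comp_contMDiffOn
    ((hψ.contMDiffOn_tangentMapWithin (m := ∞) (by simp) (uniqueMDiffOn_prod_univ hA)).comp hdir
      fun z hz ↦ hz)

theorem IsSmoothFieldOn.contMDiffOn_flowDeriv (hX : IsSmoothFieldOn X A) (hA : UniqueDiffOn ℝ A)
    (hφ : ContMDiff 𝓘(ℝ, Model m) 𝓘(ℝ, ℝ) ∞ φ) (k : ℕ) :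
    ContMDiffOn (𝓘(ℝ, P × ℝ).prod 𝓘(ℝ, Model m)) 𝓘(ℝ, ℝ) ∞ (flowDeriv X A φ k)
      ((A ×ˢ univ) ×ˢ univ) := by
  induction k with
  | zero => exact (hφ.comp contMDiff_snd).contMDiffOn
  | succ k ih => exact flowDeriv_succ X A φ k ▸ hX.contMDiffOn_lieDeriv hA ih

theorem IsTrajectoryAt.hasDerivAt_flowDeriv (hu : IsTrajectoryAt (X s) u t)
    (hX : IsSmoothFieldOn X A) (hA : UniqueDiffOn ℝ A) (hs : s ∈ A)
    (hφ : ContMDiff 𝓘(ℝ, Model m) 𝓘(ℝ, ℝ) ∞ φ) (k : ℕ) :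
    HasDerivAt (fun τ ↦ flowDeriv X A φ k ((s, τ), u τ)) (flowDeriv X A φ (k + 1) ((s, t), u t))
      t :=
  flowDeriv_succ X A φ k ▸ hu.hasDerivAt hs
    ((hX.contMDiffOn_flowDeriv hA hφ k).mdifferentiableOn (by simp) _
      ⟨⟨hs, mem_univ _⟩, mem_univ _⟩)

theorem iteratedDeriv_eq_flowDeriv (hX : IsSmoothFieldOn X A) (hA : UniqueDiffOn ℝ A)
    (hs : s ∈ A) (hφ : ContMDiff 𝓘(ℝ, Model m) 𝓘(ℝ, ℝ) ∞ φ) {O : Set ℝ} (hO : IsOpen O)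
    (hu : ∀ t ∈ O, IsTrajectoryAt (X s) u t) (k : ℕ) :
    ∀ t ∈ O, iteratedDeriv k (fun τ ↦ φ (u τ)) t = flowDeriv X A φ k ((s, t), u t) := by
  induction k with
  | zero => exact fun t _ ↦ rfl
  | succ k ih =>
    intro t ht
    have heq : iteratedDeriv k (fun τ ↦ φ (u τ)) =ᶠ[𝓝 t]
        fun τ ↦ flowDeriv X A φ k ((s, τ), u τ) :=
      eventually_of_mem (hO.mem_nhds ht) ih
    rw [iteratedDeriv_succ, heq.deriv_eq]
    exact ((hu t ht).hasDerivAt_flowDeriv hX hA hs hφ k).deriv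

end VectorField

section Testing

variable {m : ℕ} {M : Type*} [TopologicalSpace M] [T2Space M] [ChartedSpace (Model m) M]
  [IsManifold 𝓘(ℝ, Model m) ∞ M]

theorem contMDiff_bump_mul_chart {x : M} (χ : SmoothBumpFunction 𝓘(ℝ, Model m) x) (i : Fin m) :
    ContMDiff 𝓘(ℝ, Model m) 𝓘(ℝ, ℝ) ∞ (fun y ↦ χ y * extChartAt 𝓘(ℝ, Model m) x y i) :=
  χ.contMDiff_smul
    ((EuclideanSpace.proj (𝕜 := ℝ) i).contMDiff.comp_contMDiffOn contMDiffOn_extChartAt)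

theorem hasMFDerivAt_bump_mul_chart {x : M} (χ : SmoothBumpFunction 𝓘(ℝ, Model m) x)
    (i : Fin m) :
    HasMFDerivAt 𝓘(ℝ, Model m) 𝓘(ℝ, ℝ) (fun y ↦ χ y * extChartAt 𝓘(ℝ, Model m) x y i) x
      (EuclideanSpace.proj (𝕜 := ℝ) i : Model m →L[ℝ] ℝ) := by
  refine ⟨(contMDiff_bump_mul_chart χ i).continuous.continuousAt, HasFDerivAt.hasFDerivWithinAt <|
    (EuclideanSpace.proj (𝕜 := ℝ) i : Model m →L[ℝ] ℝ).hasFDerivAt.congr_of_eventuallyEq ?_⟩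
  have hχ : ∀ᶠ y in 𝓝 (extChartAt 𝓘(ℝ, Model m) x x),
      χ ((extChartAt 𝓘(ℝ, Model m) x).symm y) = 1 :=
    (continuousAt_extChartAt_symm (I := 𝓘(ℝ, Model m)) x).eventually
      (by rw [extChartAt_to_inv]; exact χ.eventuallyEq_one)
  filter_upwards [hχ, extChartAt_target_mem_nhds (I := 𝓘(ℝ, Model m)) x] with y hy hmem
  simp only [writtenInExtChartAt, Function.comp_apply, hy, one_mul,
    (extChartAt 𝓘(ℝ, Model m) x).right_inv hmem]
  rfl

/-- The derivative of a curve can be tested on the coordinates of a chart, cut off by a bump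
function. -/
theorem hasMFDerivAt_of_forall_smooth {w : ℝ → M} {t : ℝ} (hw : ContinuousAt w t)
    {v : TangentSpace 𝓘(ℝ, Model m) (w t)}
    (h : ∀ φ : M → ℝ, ContMDiff 𝓘(ℝ, Model m) 𝓘(ℝ, ℝ) ∞ φ →
      HasDerivAt (fun τ ↦ φ (w τ)) (mfderiv 𝓘(ℝ, Model m) 𝓘(ℝ, ℝ) φ (w t) v) t) :
    HasMFDerivAt 𝓘(ℝ, ℝ) 𝓘(ℝ, Model m) w t ((1 : ℝ →L[ℝ] ℝ).smulRight v) := by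
  obtain ⟨χ⟩ : Nonempty (SmoothBumpFunction 𝓘(ℝ, Model m) (w t)) := inferInstance
  have hchart : HasFDerivAt (fun τ ↦ extChartAt 𝓘(ℝ, Model m) (w t) (w τ))
      ((1 : ℝ →L[ℝ] ℝ).smulRight (v : Model m)) t := by
    rw [← hasFDerivWithinAt_univ, hasFDerivWithinAt_euclidean]
    intro i
    have hχ : ∀ᶠ τ in 𝓝 t, χ (w τ) = 1 := hw.eventually χ.eventuallyEq_one
    have hcoord := (h _ (contMDiff_bump_mul_chart χ i)).congr_of_eventuallyEq
      (f₁ := fun τ ↦ extChartAt 𝓘(ℝ, Model m) (w t) (w τ) i) (hχ.mono fun τ hτ ↦ by simp [hτ])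
    rw [(hasMFDerivAt_bump_mul_chart χ i).mfderiv] at hcoord
    rw [hasFDerivWithinAt_univ]
    exact (hasDerivAt_iff_hasFDerivAt.1 hcoord).congr_fderiv (ContinuousLinearMap.ext_ring
      ((EuclideanSpace.proj i : Model m →L[ℝ] ℝ).map_smul (1 : ℝ) v).symm)
  exact ⟨hw, hchart.hasFDerivWithinAt⟩

end Testing

section ContinuousConvergence

variable {ι κ X Y Z : Type*} [TopologicalSpace X] [TopologicalSpace Y] [TopologicalSpace Z]

/-- Continuous convergence: `F i x' → f x` as `i` runs along `p` and `x' → x`. For continuous maps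
into a uniform space this is locally uniform convergence, but it makes sense without a uniform
structure on the target. -/
def TendstoContinuously (F : ι → X → Y) (f : X → Y) (p : Filter ι) : Prop :=
  ∀ x, Tendsto (fun y : ι × X ↦ F y.1 y.2) (p ×ˢ 𝓝 x) (𝓝 (f x))

namespace TendstoContinuously

variable {F : ι → X → Y} {f : X → Y} {p : Filter ι}

theorem comp_index (h : TendstoContinuously F f p) {q : Filter κ} {j : κ → ι}
    (hj : Tendsto j q p) : TendstoContinuously (fun i ↦ F (j i)) f q := fun x ↦
  (h x).comp (hj.prodMap tendsto_id)

theorem tendsto (h : TendstoContinuously F f p) (x : X) :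
    Tendsto (fun i ↦ F i x) p (𝓝 (f x)) :=
  (h x).comp (tendsto_id.prodMk tendsto_const_nhds)

theorem postcomp (h : TendstoContinuously F f p) {φ : Y → Z} (hφ : Continuous φ) :
    TendstoContinuously (fun i x ↦ φ (F i x)) (fun x ↦ φ (f x)) p := fun x ↦
  (hφ.tendsto _).comp (h x)

theorem precomp (h : TendstoContinuously F f p) {τ : Z → X} (hτ : Continuous τ) :
    TendstoContinuously (fun i z ↦ F i (τ z)) (fun z ↦ f (τ z)) p := fun z ↦
  (h (τ z)).comp (tendsto_id.prodMap (hτ.tendsto z))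

theorem eventually_forall_mem (h : TendstoContinuously F f p) {K : Set X} (hK : IsCompact K)
    {V : Set Y} (hV : IsOpen V) (hf : MapsTo f K V) : ∀ᶠ i in p, MapsTo (F i) K V := by
  have hloc : ∀ x ∈ K, ∃ O ∈ 𝓝 x, ∀ᶠ i in p, ∀ y ∈ O, F i y ∈ V := fun x hx ↦ by
    obtain ⟨A, hA, B, hB, hAB⟩ := eventually_prod_iff.1 ((h x).eventually (hV.mem_nhds (hf hx)))
    exact ⟨{y | B y}, hB, hA.mono fun i hi y hy ↦ hAB hi hy⟩
  choose! O hO hOV using hloc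
  obtain ⟨S, hKS⟩ := hK.elim_nhds_subcover' (fun x _ ↦ O x) hO
  filter_upwards [(eventually_all_finset S).2 fun x _ ↦ hOV x x.2] with i hi y hy
  obtain ⟨x, hx, hyx⟩ := mem_iUnion₂.1 (hKS hy)
  exact hi x hx y hyx

theorem continuous [RegularSpace Y] [p.NeBot] (h : TendstoContinuously F f p) :
    Continuous f := by
  refine continuous_iff_continuousAt.2 fun x ↦
    (closed_nhds_basis (f x)).tendsto_right_iff.2 fun V hV ↦ ?_
  obtain ⟨A, hA, B, hB, hAB⟩ := eventually_prod_iff.1 ((h x).eventually hV.1)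
  exact hB.mono fun y hy ↦ hV.2.mem_of_tendsto (h.tendsto y) (hA.mono fun i hi ↦ hAB hi hy)

theorem tendstoLocallyUniformly {Y : Type*} [UniformSpace Y] {F : ι → X → Y} {f : X → Y}
    [p.NeBot] (h : TendstoContinuously F f p) : TendstoLocallyUniformly F f p := by
  refine tendstoLocallyUniformly_iff_forall_tendsto.2 fun x ↦ ?_
  have hpair : Tendsto (fun y : ι × X ↦ (f y.2, F y.1 y.2)) (p ×ˢ 𝓝 x) (𝓝 (f x, f x)) :=
    ((h.continuous.tendsto x).comp tendsto_snd).prodMk_nhds (h x)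
  exact hpair.mono_right (nhds_le_uniformity _)

end TendstoContinuously

theorem exists_subseq_tendstoContinuously {α E : Type*} [PseudoMetricSpace α]
    [LocallyCompactSpace α] [SigmaCompactSpace α] [MetricSpace E] [CompactSpace X] {e : X → E}
    (he : IsInducing e) {K : NNReal} {u : ℕ → α → X}
    (hu : ∀ ν, LipschitzWith K fun t ↦ e (u ν t)) :
    ∃ j : ℕ → ℕ, StrictMono j ∧ ∃ w, TendstoContinuously (fun ν ↦ u (j ν)) w atTop := by
  let S : Set C(α, E) := {f | LipschitzWith K f ∧ ∀ t, f t ∈ range e}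
  have hS : IsCompact S := by
    refine ArzelaAscoli.isCompact_of_equicontinuous S ?_
      (LipschitzWith.uniformEquicontinuous _ K fun f ↦ f.2.1).equicontinuous
    have himage : ContinuousMap.toFun '' S =
        (univ.pi fun _ ↦ range e) ∩ {f | LipschitzWith K f} := by
      ext f
      exact ⟨fun ⟨f, hf, hfeq⟩ ↦ hfeq ▸ ⟨fun t _ ↦ hf.2 t, hf.1⟩,
        fun ⟨hrange, hlip⟩ ↦ ⟨⟨f, hlip.continuous⟩, ⟨hlip, fun t ↦ hrange t (mem_univ t)⟩, rfl⟩⟩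
    rw [himage]
    exact (isCompact_univ_pi fun _ ↦ isCompact_range he.continuous).inter_right
      (isClosed_setOfPred_lipschitzWith K)
  obtain ⟨f, hf, j, hj, hlim⟩ := hS.tendsto_subseq
    (x := fun ν ↦ (⟨fun t ↦ e (u ν t), (hu ν).continuous⟩ : C(α, E)))
    fun ν ↦ ⟨hu ν, fun t ↦ mem_range_self _⟩
  choose w hw using hf.2
  refine ⟨j, hj, w, fun t ↦ ?_⟩
  rw [he.tendsto_nhds_iff, hw]
  exact ((f.continuous.tendsto t).comp tendsto_snd).congr_uniformity
    (tendstoLocallyUniformly_iff_forall_tendsto.1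
      (ContinuousMap.tendsto_iff_tendstoLocallyUniformly.1 hlim) t)

end ContinuousConvergence

section Limit

variable {m : ℕ} {M : Type*} [TopologicalSpace M] [ChartedSpace (Model m) M]
  {ι P : Type*} [NormedAddCommGroup P] {A : Set P} {p : Filter ι} {s : ι → P} {s₀ : P}
  {u : ι → ℝ → M} {w : ℝ → M} {X : P → ℝ → (x : M) → TangentSpace 𝓘(ℝ, Model m) x}

theorem TendstoContinuously.comp_family (h : TendstoContinuously u w p)
    (hs : Tendsto s p (𝓝[A] s₀)) (hs₀ : s₀ ∈ A) {ψ : (P × ℝ) × M → ℝ}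
    (hψ : ContinuousOn ψ ((A ×ˢ univ) ×ˢ univ)) :
    TendstoContinuously (fun i t ↦ ψ ((s i, t), u i t)) (fun t ↦ ψ ((s₀, t), w t)) p := fun t ↦ by
  have hparam : Tendsto (fun y : ι × ℝ ↦ ((s y.1, y.2), u y.1 y.2)) (p ×ˢ 𝓝 t)
      (𝓝[(A ×ˢ univ) ×ˢ univ] ((s₀, t), w t)) := by
    simp only [nhdsWithin_prod_eq, nhdsWithin_univ]
    exact ((hs.comp tendsto_fst).prodMk tendsto_snd).prodMk (h t)
  exact (hψ _ ⟨⟨hs₀, mem_univ _⟩, mem_univ _⟩).tendsto.comp hparam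

theorem exists_isOpen_forall_isTrajectoryAt {t : ℝ} (hs : Tendsto s p (𝓝[A] s₀))
    (hu : ∀ᶠ y : ι × ℝ in p ×ˢ 𝓝 t, IsTrajectoryAt (X (s y.1)) (u y.1) y.2) :
    ∃ O : Set ℝ, IsOpen O ∧ t ∈ O ∧
      ∀ᶠ i in p, s i ∈ A ∧ ∀ τ ∈ O, IsTrajectoryAt (X (s i)) (u i) τ := by
  obtain ⟨C, hC, B, hB, hCB⟩ := eventually_prod_iff.1 hu
  obtain ⟨O, hOB, hO, htO⟩ := mem_nhds_iff.1 hB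
  exact ⟨O, hO, htO, (hs.eventually self_mem_nhdsWithin).and
    (hC.mono fun i hi τ hτ ↦ hCB hi (hOB hτ))⟩

variable [NormedSpace ℝ P] [IsManifold 𝓘(ℝ, Model m) ∞ M] [T3Space M]

theorem TendstoContinuously.isTrajectoryAt [p.NeBot] (h : TendstoContinuously u w p)
    (hX : IsSmoothFieldOn X A) (hA : UniqueDiffOn ℝ A) (hs : Tendsto s p (𝓝[A] s₀))
    (hs₀ : s₀ ∈ A) {t : ℝ}
    (hu : ∀ᶠ y : ι × ℝ in p ×ˢ 𝓝 t, IsTrajectoryAt (X (s y.1)) (u y.1) y.2) :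
    IsTrajectoryAt (X s₀) w t := by
  refine hasMFDerivAt_of_forall_smooth h.continuous.continuousAt fun φ hφ ↦ ?_
  obtain ⟨O, hO, htO, hflow⟩ := exists_isOpen_forall_isTrajectoryAt hs hu
  have hderiv := (h.comp_family hs hs₀
    (hX.contMDiffOn_flowDeriv hA hφ 1).continuousOn).tendstoLocallyUniformly
  have hmd := hφ.mdifferentiable (by simp)
  have hlim := hasDerivAt_of_tendstoLocallyUniformlyOn hO hderiv.tendstoLocallyUniformlyOn
    (hflow.mono fun i hi τ hτ ↦ (hi.2 τ hτ).hasDerivAt_flowDeriv hX hA hi.1 hφ 0)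
    (fun τ _ ↦ (h.postcomp hφ.continuous).tendsto τ) htO
  exact flowDeriv_one (X := X) (z := ((s₀, t), w t)) hA hmd hs₀ ▸ hlim

theorem TendstoContinuously.tendstoCinftyLoc {s : ℕ → P} {u : ℕ → ℝ → M}
    (h : TendstoContinuously u w atTop) (hX : IsSmoothFieldOn X A) (hA : UniqueDiffOn ℝ A)
    (hs : Tendsto s atTop (𝓝[A] s₀)) (hs₀ : s₀ ∈ A)
    (hu : ∀ t, ∀ᶠ y : ℕ × ℝ in atTop ×ˢ 𝓝 t, IsTrajectoryAt (X (s y.1)) (u y.1) y.2) :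
    TendstoCinftyLoc m u w := by
  intro φ hφ k
  have hw : iteratedDeriv k (fun t ↦ φ (w t)) = fun t ↦ flowDeriv X A φ k ((s₀, t), w t) :=
    funext fun t ↦ iteratedDeriv_eq_flowDeriv hX hA hs₀ hφ isOpen_univ
      (fun t _ ↦ h.isTrajectoryAt hX hA hs hs₀ (hu t)) k t (mem_univ t)
  rw [hw]
  refine TendstoContinuously.tendstoLocallyUniformly fun t ↦ ?_
  refine (h.comp_family hs hs₀ (hX.contMDiffOn_flowDeriv hA hφ k).continuousOn t).congr' ?_
  obtain ⟨O, hO, htO, hflow⟩ := exists_isOpen_forall_isTrajectoryAt hs (hu t)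
  refine eventually_prod_iff.2 ⟨_, hflow, (· ∈ O), hO.mem_nhds htO, fun {ν} hν {τ} hτ ↦ ?_⟩
  exact (iteratedDeriv_eq_flowDeriv hX hA hν.1 hφ hO hν.2 k τ hτ).symm

end Limit

section Energy

variable {m : ℕ} {M : Type*} [TopologicalSpace M] [ChartedSpace (Model m) M]
  [IsManifold 𝓘(ℝ, Model m) ∞ M] {f φ : M → ℝ}

theorem inner_self_nonneg (g : Metric m M) (x : M) (v : TangentSpace 𝓘(ℝ, Model m) x) :
    0 ≤ g.inner x v v := by
  by_cases h : v = 0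
  · simp [h]
  · exact (g.pos x v h).le

theorem inner_sq_le (g : Metric m M) (x : M) (v w : TangentSpace 𝓘(ℝ, Model m) x) :
    (g.inner x v w) ^ 2 ≤ g.inner x v v * g.inner x w w :=
  let B : LinearMap.BilinForm ℝ (TangentSpace 𝓘(ℝ, Model m) x) :=
    LinearMap.mk₂ ℝ (fun v w ↦ g.inner x v w) (by simp) (by simp) (by simp) (by simp)
  B.apply_sq_le_of_symm (inner_self_nonneg g x) ⟨g.symm x⟩ v w

/-- The squared norm `|∇_g f|²` of the gradient, the rate at which `f` decreases along flow
lines. -/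
noncomputable def gradSq (g : Metric m M) (f : M → ℝ) (x : M) : ℝ :=
  g.inner x (gradient g f x) (gradient g f x)

theorem gradSq_nonneg (g : Metric m M) (f : M → ℝ) (x : M) : 0 ≤ gradSq g f x :=
  inner_self_nonneg g x _

theorem gradSq_eq_zero_iff (g : Metric m M) (f : M → ℝ) (x : M) :
    gradSq g f x = 0 ↔ IsCritical m f x := by
  constructor <;> intro h
  · have hgrad : gradient g f x = 0 := not_imp_not.1 (fun hne ↦ (g.pos x _ hne).ne') h
    refine ContinuousLinearMap.ext fun w ↦ ?_
    rw [← inner_gradient g, hgrad, map_zero]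
    rfl
  · rw [gradSq, inner_gradient, show mfderiv 𝓘(ℝ, Model m) 𝓘(ℝ, ℝ) f x = 0 from h]
    rfl

theorem contMDiff_gradient (g : Metric m M) (hf : ContMDiff 𝓘(ℝ, Model m) 𝓘(ℝ, ℝ) ∞ f) :
    ContMDiff 𝓘(ℝ, Model m) 𝓘(ℝ, Model m).tangent ∞
      (fun x ↦ (⟨x, gradient g f x⟩ : TangentBundle 𝓘(ℝ, Model m) M)) :=
  (contMDiffOn_gradient (B := univ) (F := fun _ : ℝ ↦ f) (g := fun _ ↦ g)
    (hf.comp contMDiff_snd).contMDiffOn (g.contMDiff.comp contMDiff_snd).contMDiffOn).comp_contMDiff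
    (contMDiff_const.prodMk contMDiff_id : ContMDiff _ _ ∞ fun x : M ↦ ((0 : ℝ), x))
    fun _ ↦ ⟨mem_univ _, mem_univ _⟩

theorem contMDiff_gradSq (g : Metric m M) (hf : ContMDiff 𝓘(ℝ, Model m) 𝓘(ℝ, ℝ) ∞ f) :
    ContMDiff 𝓘(ℝ, Model m) 𝓘(ℝ, ℝ) ∞ (gradSq g f) :=
  ((contMDiff_snd_tangentBundle_modelSpace ℝ 𝓘(ℝ, ℝ)).comp
    ((hf.contMDiff_tangentMap (m := ∞) (by simp)).comp (contMDiff_gradient g hf))).congr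
    fun x ↦ inner_gradient g f x _

theorem isSmoothFieldOn_neg_gradient {P : Type*} [NormedAddCommGroup P] [NormedSpace ℝ P]
    {A : Set P} {H : P → ℝ → M → ℝ} {G : P → ℝ → Metric m M}
    (hH : ContMDiffOn (𝓘(ℝ, P × ℝ).prod 𝓘(ℝ, Model m)) 𝓘(ℝ, ℝ) ∞
      (fun z : (P × ℝ) × M ↦ H z.1.1 z.1.2 z.2) ((A ×ˢ univ) ×ˢ univ))
    (hG : IsSmoothMetricOn (fun q : P × ℝ ↦ G q.1 q.2) (A ×ˢ univ)) :
    IsSmoothFieldOn (fun s t x ↦ -gradient (G s t) (H s t) x) A := by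
  simp_rw [IsSmoothFieldOn, ← gradient_neg]
  exact contMDiffOn_gradient (F := fun q : P × ℝ ↦ -H q.1 q.2) hH.neg hG

theorem isSmoothFieldOn_const_neg_gradient (g : Metric m M)
    (hf : ContMDiff 𝓘(ℝ, Model m) 𝓘(ℝ, ℝ) ∞ f) :
    IsSmoothFieldOn (fun (_ : ℝ) _ x ↦ -gradient g f x) univ :=
  isSmoothFieldOn_neg_gradient (hf.comp contMDiff_snd).contMDiffOn
    (g.contMDiff.comp contMDiff_snd).contMDiffOn

theorem IsTrajectoryAt.hasDerivAt_comp_neg_gradient {g : Metric m M} {u : ℝ → M} {t : ℝ}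
    (hu : IsTrajectoryAt (fun _ x ↦ -gradient g f x) u t)
    (hφ : MDifferentiableAt 𝓘(ℝ, Model m) 𝓘(ℝ, ℝ) φ (u t)) :
    HasDerivAt (fun τ ↦ φ (u τ)) (-g.inner (u t) (gradient g φ (u t)) (gradient g f (u t))) t :=
  (hu.hasDerivAt_comp hφ).congr_deriv <| by
    rw [inner_gradient]
    exact map_neg _ _

theorem exists_inner_gradient_sq_le [CompactSpace M] (g : Metric m M) (f : M → ℝ)
    (hφ : ContMDiff 𝓘(ℝ, Model m) 𝓘(ℝ, ℝ) ∞ φ) :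
    ∃ C : ℝ, 0 ≤ C ∧ ∀ x, (g.inner x (gradient g φ x) (gradient g f x)) ^ 2 ≤ C * gradSq g f x := by
  obtain ⟨C, hC⟩ := isCompact_univ.bddAbove_image (contMDiff_gradSq g hφ).continuous.continuousOn
  exact ⟨max C 0, le_max_right _ _, fun x ↦ (inner_sq_le g x _ _).trans
    (mul_le_mul_of_nonneg_right ((hC ⟨x, mem_univ x, rfl⟩).trans (le_max_left _ _))
      (gradSq_nonneg g f x))⟩

end Energy

section Morse

variable {m : ℕ} {M : Type*} [TopologicalSpace M] [ChartedSpace (Model m) M]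
  [IsManifold 𝓘(ℝ, Model m) ∞ M] {f φ : M → ℝ} {c x : M}

theorem eventually_inner_trivializationAt_symm_le (g : Metric m M) (c : M) :
    ∃ C : ℝ, 0 ≤ C ∧ ∀ᶠ x in 𝓝 c, ∀ w : Model m, g.inner x
      ((trivializationAt (Model m) (TangentSpace 𝓘(ℝ, Model m)) c).symm x w)
      ((trivializationAt (Model m) (TangentSpace 𝓘(ℝ, Model m)) c).symm x w) ≤ C * ‖w‖ ^ 2 := by
  have ha := ((contMDiffAt_hom_bundle _).1 (g.contMDiff c)).2
  set a : M → Model m →L[ℝ] Model m →L[ℝ] ℝ := fun z ↦ _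
  change ContMDiffAt _ _ _ a _ at ha
  refine ⟨‖a c‖ + 1, by positivity, ?_⟩
  have hnorm : Tendsto (fun x ↦ ‖a x‖) (𝓝 c) (𝓝 ‖a c‖) :=
    (continuous_norm.tendsto (a c)).comp ha.continuousAt.tendsto
  filter_upwards [hnorm.eventually (eventually_lt_nhds (lt_add_one _)),
    (trivializationAt (Model m) (TangentSpace 𝓘(ℝ, Model m)) c).open_baseSet.mem_nhds
      (FiberBundle.mem_baseSet_trivializationAt' c)] with x hx hxe w
  rw [← inCoordinates_bilin_apply hxe]
  calc a x w w ≤ ‖a x w w‖ := le_abs_self _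
    _ ≤ ‖a x‖ * ‖w‖ * ‖w‖ := (a x).le_opNorm₂ w w
    _ ≤ (‖a c‖ + 1) * ‖w‖ ^ 2 := by
      rw [mul_assoc, ← sq]
      gcongr

theorem contDiffAt_comp_extChartAt_symm (hφ : ContMDiff 𝓘(ℝ, Model m) 𝓘(ℝ, ℝ) ∞ φ) (c : M)
    {y : Model m} (hy : y ∈ (extChartAt 𝓘(ℝ, Model m) c).target) :
    ContDiffAt ℝ ∞ (φ ∘ (extChartAt 𝓘(ℝ, Model m) c).symm) y :=
  (hφ.contMDiffAt.comp y ((contMDiffOn_extChartAt_symm c).contMDiffAt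
    ((isOpen_extChartAt_target c).mem_nhds hy))).contDiffAt

theorem fderiv_comp_extChartAt_symm_apply (hx : x ∈ (extChartAt 𝓘(ℝ, Model m) c).source)
    (hf : MDifferentiableAt 𝓘(ℝ, Model m) 𝓘(ℝ, ℝ) f x) (w : Model m) :
    fderiv ℝ (f ∘ (extChartAt 𝓘(ℝ, Model m) c).symm) (extChartAt 𝓘(ℝ, Model m) c x) w =
      mfderiv 𝓘(ℝ, Model m) 𝓘(ℝ, ℝ) f x
        ((trivializationAt (Model m) (TangentSpace 𝓘(ℝ, Model m)) c).symm x w) := by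
  set ξ := extChartAt 𝓘(ℝ, Model m) c with hξ
  have hxb : x ∈ (trivializationAt (Model m) (TangentSpace 𝓘(ℝ, Model m)) c).baseSet := by
    simpa [hξ] using hx
  have hsymm : MDifferentiableAt 𝓘(ℝ, Model m) 𝓘(ℝ, Model m) ξ.symm (ξ x) :=
    ((contMDiffOn_extChartAt_symm (n := ∞) c).contMDiffAt
      ((isOpen_extChartAt_target c).mem_nhds (ξ.map_source hx))).mdifferentiableAt (by simp)
  have htriv := TangentBundle.symmL_trivializationAt (I := 𝓘(ℝ, Model m)) (x₀ := c) (x := x)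
    (by simpa [hξ] using hx)
  rw [ModelWithCorners.range_eq_univ, mfderivWithin_univ] at htriv
  have hw := (Bundle.Trivialization.symmL_apply _ hxb w).symm.trans
    (congrArg (fun L : Model m →L[ℝ] Model m ↦ L w) htriv)
  let D : M → Model m →L[ℝ] ℝ := fun y ↦ mfderiv 𝓘(ℝ, Model m) 𝓘(ℝ, ℝ) f y
  have hD : D (ξ.symm (ξ x)) = D x := congrArg D (ξ.left_inv hx)
  have hcomp : fderiv ℝ (f ∘ ξ.symm) (ξ x) =
      (D (ξ.symm (ξ x))).comp (mfderiv 𝓘(ℝ, Model m) 𝓘(ℝ, Model m) ξ.symm (ξ x)) := by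
    rw [← mfderiv_eq_fderiv]
    exact mfderiv_comp_of_eq hf hsymm (ξ.left_inv hx)
  rw [hcomp, hD]
  exact congrArg (D x) hw.symm

theorem isCritical_iff_fderiv_eq_zero (hx : x ∈ (extChartAt 𝓘(ℝ, Model m) c).source)
    (hf : MDifferentiableAt 𝓘(ℝ, Model m) 𝓘(ℝ, ℝ) f x) :
    IsCritical m f x ↔
      fderiv ℝ (f ∘ (extChartAt 𝓘(ℝ, Model m) c).symm) (extChartAt 𝓘(ℝ, Model m) c x) = 0 := by
  refine ⟨fun h ↦ ContinuousLinearMap.ext fun w ↦ ?_, fun h ↦ ContinuousLinearMap.ext fun v ↦ ?_⟩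
  · rw [fderiv_comp_extChartAt_symm_apply hx hf, show mfderiv _ _ f x = 0 from h]
    rfl
  · have hxb : x ∈ (trivializationAt (Model m) (TangentSpace 𝓘(ℝ, Model m)) c).baseSet := by
      simpa using hx
    have hv := fderiv_comp_extChartAt_symm_apply hx hf
      (trivializationAt (Model m) (TangentSpace 𝓘(ℝ, Model m)) c ⟨x, v⟩).2
    rw [h, Bundle.Trivialization.symm_apply_apply_mk _ hxb] at hv
    exact hv.symm

theorem isClosed_setOf_isCritical (hf : ContMDiff 𝓘(ℝ, Model m) 𝓘(ℝ, ℝ) ∞ f) :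
    IsClosed {x | IsCritical m f x} := by
  refine isOpen_compl_iff.1 (isOpen_iff_mem_nhds.2 fun c hc ↦ ?_)
  have hmd := hf.mdifferentiable (by simp)
  have hcont : ContinuousAt (fun x ↦ fderiv ℝ (f ∘ (extChartAt 𝓘(ℝ, Model m) c).symm)
      (extChartAt 𝓘(ℝ, Model m) c x)) c :=
    ((contDiffAt_comp_extChartAt_symm hf c (mem_extChartAt_target c)).fderiv_right
      (m := 0) (by norm_cast)).continuousAt.comp (continuousAt_extChartAt c)
  have hne := (isCritical_iff_fderiv_eq_zero (mem_extChartAt_source c) (hmd c)).not.1 hc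
  filter_upwards [hcont.eventually_ne hne, extChartAt_source_mem_nhds (I := 𝓘(ℝ, Model m)) c]
    with x hx hxs
  exact (isCritical_iff_fderiv_eq_zero hxs (hmd x)).not.2 hx

theorem eventually_norm_fderiv_sq_le (g : Metric m M)
    (hf : MDifferentiable 𝓘(ℝ, Model m) 𝓘(ℝ, ℝ) f) (c : M) :
    ∃ C : ℝ, 0 ≤ C ∧ ∀ᶠ x in 𝓝 c, ‖fderiv ℝ (f ∘ (extChartAt 𝓘(ℝ, Model m) c).symm)
      (extChartAt 𝓘(ℝ, Model m) c x)‖ ^ 2 ≤ C * gradSq g f x := by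
  obtain ⟨C, hC₀, hC⟩ := eventually_inner_trivializationAt_symm_le g c
  refine ⟨C, hC₀, ?_⟩
  filter_upwards [hC, extChartAt_source_mem_nhds (I := 𝓘(ℝ, Model m)) c] with x hx hxs
  have hgrad := gradSq_nonneg g f x
  refine Real.le_sqrt (norm_nonneg _) (by positivity) |>.1 <|
    ContinuousLinearMap.opNorm_le_bound _ (Real.sqrt_nonneg _) fun w ↦ ?_
  rw [fderiv_comp_extChartAt_symm_apply hxs (hf x), ← inner_gradient g, Real.norm_eq_abs]
  refine abs_le_of_sq_le_sq ((inner_sq_le g _ _ _).trans ?_) (by positivity)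
  rw [mul_pow, Real.sq_sqrt (by positivity), mul_right_comm, mul_comm]
  exact mul_le_mul_of_nonneg_right (hx w) hgrad

theorem IsMorse.isBigO_fderiv (hf : IsMorse m f) (hc : IsCritical m f c) :
    (fun x ↦ extChartAt 𝓘(ℝ, Model m) c x - extChartAt 𝓘(ℝ, Model m) c c) =O[𝓝 c]
      fun x ↦ fderiv ℝ (f ∘ (extChartAt 𝓘(ℝ, Model m) c).symm) (extChartAt 𝓘(ℝ, Model m) c x) := by
  set ξ := extChartAt 𝓘(ℝ, Model m) c
  have hzero : fderiv ℝ (f ∘ ξ.symm) (ξ c) = 0 :=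
    (isCritical_iff_fderiv_eq_zero (mem_extChartAt_source c)
      (hf.smooth.mdifferentiableAt (by simp))).1 hc
  have hderiv : HasFDerivAt (fderiv ℝ (f ∘ ξ.symm)) (hessian m f c) (ξ c) :=
    (((contDiffAt_comp_extChartAt_symm hf.smooth c (mem_extChartAt_target c)).fderiv_right
      (m := 1) (by norm_cast)).differentiableAt (by simp)).hasFDerivAt
  have hker : (hessian m f c).toLinearMap.ker = ⊥ := LinearMap.ker_eq_bot'.2 fun v hv ↦
    hf.nondegenerate c hc v fun w ↦ congrArg (fun L : Model m →L[ℝ] ℝ ↦ L w) hv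
  have hbigO := (hderiv.isTheta_sub
    (LinearMap.isClosedEmbedding_of_injective hker).isInducing).isBigO_symm
  simp only [hzero, sub_zero] at hbigO
  exact hbigO.comp_tendsto (continuousAt_extChartAt (I := 𝓘(ℝ, Model m)) c)

/-- Both sides vanish to second order at `c`: this is how nondegeneracy enters the convergence at
the ends. -/
theorem IsMorse.eventually_sub_sq_le (hf : IsMorse m f) (g : Metric m M)
    (hc : IsCritical m f c) (hφ : ContMDiff 𝓘(ℝ, Model m) 𝓘(ℝ, ℝ) ∞ φ) :
    ∃ C : ℝ, ∀ᶠ x in 𝓝 c, (φ x - φ c) ^ 2 ≤ C * gradSq g f x := by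
  obtain ⟨C₁, -, hC₁⟩ := eventually_norm_fderiv_sq_le g (hf.smooth.mdifferentiable (by simp)) c
  have hφO := ((contDiffAt_comp_extChartAt_symm hφ c
    (mem_extChartAt_target c)).differentiableAt (by simp)).hasFDerivAt.isBigO_sub
  obtain ⟨C₂, hC₂⟩ := ((hφO.comp_tendsto (continuousAt_extChartAt c)).trans
    (hf.isBigO_fderiv hc)).bound
  refine ⟨C₂ ^ 2 * C₁, ?_⟩
  filter_upwards [hC₁, hC₂, extChartAt_source_mem_nhds (I := 𝓘(ℝ, Model m)) c] with x h₁ h₂ hx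
  simp only [Function.comp_apply, (extChartAt 𝓘(ℝ, Model m) c).left_inv hx, extChartAt_to_inv,
    Real.norm_eq_abs] at h₂
  rw [← sq_abs]
  calc _ ≤ (C₂ * _) ^ 2 := by gcongr
    _ = C₂ ^ 2 * _ ^ 2 := mul_pow ..
    _ ≤ C₂ ^ 2 * (C₁ * gradSq g f x) := by gcongr
    _ = _ := (mul_assoc ..).symm

theorem IsMorse.eventually_eq_of_isCritical (hf : IsMorse m f) (hc : IsCritical m f c) :
    ∀ᶠ x in 𝓝 c, IsCritical m f x → x = c := by
  obtain ⟨C, hC⟩ := (hf.isBigO_fderiv hc).bound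
  filter_upwards [hC, extChartAt_source_mem_nhds (I := 𝓘(ℝ, Model m)) c] with x hx hxs hcrit
  rw [(isCritical_iff_fderiv_eq_zero hxs (hf.smooth.mdifferentiableAt (by simp))).1 hcrit,
    norm_zero, mul_zero, norm_le_zero_iff, sub_eq_zero] at hx
  exact (extChartAt 𝓘(ℝ, Model m) c).injOn hxs (mem_extChartAt_source c) hx

theorem IsMorse.finite_critical [CompactSpace M] (hf : IsMorse m f) :
    {x | IsCritical m f x}.Finite := by
  by_contra hinf
  obtain ⟨c, -, hacc⟩ := Set.Infinite.exists_accPt_of_subset_isCompact hinf isCompact_univ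
    (subset_univ _)
  have hc : IsCritical m f c := (isClosed_setOf_isCritical hf.smooth).closure_subset
    (mem_closure_iff_clusterPt.2 hacc.clusterPt)
  obtain ⟨x, hx, hxc⟩ :=
    ((accPt_iff_frequently.1 hacc).and_eventually (hf.eventually_eq_of_isCritical hc)).exists
  exact hx.1 (hxc hx.2)

variable (m) in
/-- `V` is an isolating neighbourhood of `c`: a closed neighbourhood in which `c` is the only
possible critical point of `f`. -/
structure IsIsolating (f : M → ℝ) (c : M) (V : Set M) : Prop where
  mem_nhds : V ∈ 𝓝 c
  isClosed : IsClosed V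
  eq_of_isCritical : ∀ x ∈ V, IsCritical m f x → x = c

theorem IsMorse.exists_isIsolating [RegularSpace M] (hf : IsMorse m f) (hc : IsCritical m f c)
    {U : Set M} (hU : U ∈ 𝓝 c) : ∃ V ⊆ U, IsIsolating m f c V := by
  obtain ⟨V, hV, hVc, hVU⟩ := exists_mem_nhds_isClosed_subset
    (inter_mem hU (hf.eventually_eq_of_isCritical hc))
  exact ⟨V, fun x hx ↦ (hVU hx).1, hV, hVc, fun x hx ↦ (hVU hx).2⟩

theorem exists_le_gradSq (hf : ContMDiff 𝓘(ℝ, Model m) 𝓘(ℝ, ℝ) ∞ f) (g : Metric m M)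
    {K : Set M} (hK : IsCompact K) (hcrit : ∀ x ∈ K, ¬ IsCritical m f x) :
    ∃ δ > 0, ∀ x ∈ K, δ ≤ gradSq g f x :=
  hK.exists_forall_le' (contMDiff_gradSq g hf).continuous.continuousOn fun x hx ↦
    (gradSq_nonneg g f x).lt_of_ne' ((gradSq_eq_zero_iff g f x).not.2 (hcrit x hx))

theorem IsMorse.exists_sub_sq_le [CompactSpace M] (hf : IsMorse m f) (g : Metric m M)
    (hc : IsCritical m f c) {V : Set M} (hV : IsIsolating m f c V)
    (hφ : ContMDiff 𝓘(ℝ, Model m) 𝓘(ℝ, ℝ) ∞ φ) :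
    ∃ C : ℝ, 0 ≤ C ∧ ∀ x ∈ V, (φ x - φ c) ^ 2 ≤ C * gradSq g f x := by
  obtain ⟨C, hC⟩ := hf.eventually_sub_sq_le g hc hφ
  obtain ⟨U, hU, hUo, hcU⟩ := mem_nhds_iff.1 hC
  obtain ⟨δ, hδ, hgrad⟩ := exists_le_gradSq hf.smooth g (hV.isClosed.isCompact.diff hUo)
    fun x hx h ↦ hx.2 (hV.eq_of_isCritical x hx.1 h ▸ hcU)
  obtain ⟨B, hB⟩ := isCompact_univ.bddAbove_image
    (f := fun x ↦ (φ x - φ c) ^ 2) ((hφ.continuous.sub continuous_const).pow 2).continuousOn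
  have hBx : ∀ x, (φ x - φ c) ^ 2 ≤ B := fun x ↦ hB ⟨x, mem_univ x, rfl⟩
  have hB₀ : 0 ≤ B := (sq_nonneg _).trans (hBx c)
  refine ⟨max C (B / δ), le_max_of_le_right (by positivity), fun x hx ↦ ?_⟩
  rw [max_mul_of_nonneg _ _ (gradSq_nonneg g f x)]
  by_cases hxU : x ∈ U
  · exact le_max_of_le_left (hU hxU)
  · refine le_max_of_le_right ((hBx x).trans ?_)
    rw [div_mul_eq_mul_div, le_div_iff₀ hδ]
    exact mul_le_mul_of_nonneg_left (hgrad x ⟨hx, hxU⟩) hB₀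

end Morse

theorem tendsto_zero_of_integrableOn_of_abs_deriv_le {ρ : ℝ → ℝ} {T B C : ℝ}
    (hint : IntegrableOn ρ (Ioi T)) (hdiff : ∀ t > T, DifferentiableAt ℝ ρ t)
    (hB : ∀ t > T, |ρ t| ≤ B) (hC : ∀ t > T, |deriv ρ t| ≤ C) : Tendsto ρ atTop (𝓝 0) := by
  have hderiv : ∀ t ∈ Ioi T, HasDerivAt (fun t ↦ ρ t ^ 2) (2 * (deriv ρ t * ρ t)) t := fun t ht ↦
    ((hdiff t ht).hasDerivAt.pow 2).congr_deriv (by push_cast; ring)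
  have hsq : IntegrableOn (fun t ↦ ρ t ^ 2) (Ioi T) := by
    simp only [sq]
    exact hint.bdd_mul hint.aestronglyMeasurable
      ((ae_restrict_mem measurableSet_Ioi).mono fun t ht ↦ hB t ht)
  have hsq' : IntegrableOn (fun t ↦ 2 * (deriv ρ t * ρ t)) (Ioi T) :=
    (hint.bdd_mul (measurable_deriv ρ).aestronglyMeasurable
      ((ae_restrict_mem measurableSet_Ioi).mono fun t ht ↦ hC t ht)).const_mul 2
  have hlim := (Real.continuous_sqrt.tendsto 0).comp
    (tendsto_zero_of_hasDerivAt_of_integrableOn_Ioi hderiv hsq' hsq)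
  rw [Real.sqrt_zero] at hlim
  exact tendsto_zero_iff_abs_tendsto_zero _ |>.2 (hlim.congr fun t ↦ Real.sqrt_sq_eq_abs _)

section HalfLine

variable {m : ℕ} {M : Type*} [TopologicalSpace M] [ChartedSpace (Model m) M]
  [IsManifold 𝓘(ℝ, Model m) ∞ M]

/-- The curve `u` solves `u' = -∇_g f (u)` on the half-line `(T, ∞)`. Solutions near `-∞` are
treated by reversing time, which replaces `f` by `-f`. -/
def FlowsAfter (g : Metric m M) (f : M → ℝ) (T : ℝ) (u : ℝ → M) : Prop :=
  ∀ t > T, IsTrajectoryAt (fun _ x ↦ -gradient g f x) u t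

variable {f φ : M → ℝ} {g : Metric m M} {T : ℝ} {u : ℝ → M} {c : M}

namespace FlowsAfter

theorem mono (hu : FlowsAfter g f T u) {R : ℝ} (hR : T ≤ R) : FlowsAfter g f R u :=
  fun t ht ↦ hu t (hR.trans_lt ht)

theorem hasDerivAt (hf : MDifferentiable 𝓘(ℝ, Model m) 𝓘(ℝ, ℝ) f) (hu : FlowsAfter g f T u)
    {t : ℝ} (ht : T < t) : HasDerivAt (fun τ ↦ f (u τ)) (-gradSq g f (u t)) t :=
  (hu t ht).hasDerivAt_comp_neg_gradient (hf _)

theorem antitoneOn (hf : MDifferentiable 𝓘(ℝ, Model m) 𝓘(ℝ, ℝ) f) (hu : FlowsAfter g f T u)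
    (hc : Continuous u) : AntitoneOn (fun t ↦ f (u t)) (Ici T) := by
  refine antitoneOn_of_hasDerivWithinAt_nonpos (convex_Ici T)
    (hf.continuous.comp hc).continuousOn (f' := fun t ↦ -gradSq g f (u t)) ?_
    fun t _ ↦ neg_nonpos.2 (gradSq_nonneg g f _)
  rw [interior_Ici]
  exact fun t ht ↦ (hu.hasDerivAt hf ht).hasDerivWithinAt

theorem deriv_comp (hφ : ContMDiff 𝓘(ℝ, Model m) 𝓘(ℝ, ℝ) ∞ φ) (hu : FlowsAfter g f T u) {t : ℝ}
    (ht : T < t) : deriv (fun τ ↦ φ (u τ)) t =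
      -g.inner (u t) (gradient g φ (u t)) (gradient g f (u t)) :=
  ((hu t ht).hasDerivAt_comp_neg_gradient (hφ.mdifferentiableAt (by simp))).deriv

variable [CompactSpace M]

theorem exists_tendsto_value (hf : MDifferentiable 𝓘(ℝ, Model m) 𝓘(ℝ, ℝ) f)
    (hu : FlowsAfter g f T u) (hc : Continuous u) :
    ∃ l, Tendsto (fun t ↦ f (u t)) atTop (𝓝 l) := by
  have hanti : Antitone fun t ↦ f (u (max t T)) := fun a b hab ↦
    hu.antitoneOn hf hc (le_max_right a T) (le_max_right b T) (max_le_max_right T hab)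
  have hbdd : BddBelow (range fun t ↦ f (u (max t T))) :=
    (isCompact_range hf.continuous).bddBelow.mono (range_comp_subset_range _ f)
  refine ⟨_, (tendsto_atTop_ciInf hanti hbdd).congr' ?_⟩
  filter_upwards [eventually_ge_atTop T] with t ht
  rw [max_eq_left ht]

theorem integrableOn_gradSq (hf : MDifferentiable 𝓘(ℝ, Model m) 𝓘(ℝ, ℝ) f)
    (hu : FlowsAfter g f T u) (hc : Continuous u) :
    IntegrableOn (fun t ↦ gradSq g f (u t)) (Ioi T) := by
  obtain ⟨l, hl⟩ := hu.exists_tendsto_value hf hc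
  simpa using (integrableOn_Ioi_deriv_of_nonpos (a := T)
    (hf.continuous.comp hc).continuousWithinAt (fun t ht ↦ hu.hasDerivAt hf ht)
    (fun t _ ↦ neg_nonpos.2 (gradSq_nonneg g f _)) hl).neg

theorem lintegral_gradSq (hf : MDifferentiable 𝓘(ℝ, Model m) 𝓘(ℝ, ℝ) f)
    (hu : FlowsAfter g f T u) (hc : Continuous u) (hlim : Tendsto u atTop (𝓝 c)) :
    ∫⁻ t in Ioi T, ENNReal.ofReal (gradSq g f (u t)) = ENNReal.ofReal (f (u T) - f c) := by
  rw [← ofReal_integral_eq_lintegral_ofReal (hu.integrableOn_gradSq hf hc)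
    (Eventually.of_forall fun t ↦ gradSq_nonneg g f _)]
  have h := integral_Ioi_of_hasDerivAt_of_nonpos (a := T)
    (hf.continuous.comp hc).continuousWithinAt (fun t ht ↦ hu.hasDerivAt hf ht)
    (fun t _ ↦ neg_nonpos.2 (gradSq_nonneg g f _)) ((hf.continuous.tendsto c).comp hlim)
  rw [integral_neg, neg_eq_iff_eq_neg, neg_sub] at h
  exact congrArg ENNReal.ofReal h

theorem tendsto_gradSq (hf : ContMDiff 𝓘(ℝ, Model m) 𝓘(ℝ, ℝ) ∞ f) (hu : FlowsAfter g f T u)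
    (hc : Continuous u) : Tendsto (fun t ↦ gradSq g f (u t)) atTop (𝓝 0) := by
  have hρ := contMDiff_gradSq g hf
  obtain ⟨B, hB⟩ := isCompact_univ.exists_bound_of_continuousOn hρ.continuous.continuousOn
  obtain ⟨C, hC₀, hC⟩ := exists_inner_gradient_sq_le g f hρ
  have hderiv := fun t (ht : t > T) ↦
    (hu t ht).hasDerivAt_comp_neg_gradient (hρ.mdifferentiableAt (by simp))
  refine tendsto_zero_of_integrableOn_of_abs_deriv_le (B := B) (C := √(C * B))
    (hu.integrableOn_gradSq (hf.mdifferentiable (by simp)) hc)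
    (fun t ht ↦ (hderiv t ht).differentiableAt) (fun t _ ↦ hB _ (mem_univ _)) fun t ht ↦ ?_
  rw [(hderiv t ht).deriv, abs_neg]
  exact Real.abs_le_sqrt ((hC _).trans
    (mul_le_mul_of_nonneg_left ((le_abs_self _).trans (hB _ (mem_univ _))) hC₀))

theorem isCritical_of_mapClusterPt (hf : ContMDiff 𝓘(ℝ, Model m) 𝓘(ℝ, ℝ) ∞ f)
    (hu : FlowsAfter g f T u) (hc : Continuous u) (h : MapClusterPt c atTop u) :
    IsCritical m f c :=
  (gradSq_eq_zero_iff g f c).1 <| eq_of_nhds_neBot <|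
    (h.tendsto_comp (contMDiff_gradSq g hf).continuous.continuousAt).clusterPt.neBot.mono
      (inf_le_inf_left _ (hu.tendsto_gradSq hf hc))

/-- Once `|∇f|²` is below its minimum on the frontier of `V`, the curve cannot leave `V`. -/
theorem eventually_mem_of_isIsolating (hf : ContMDiff 𝓘(ℝ, Model m) 𝓘(ℝ, ℝ) ∞ f)
    (hu : FlowsAfter g f T u) (hc : Continuous u) (h : MapClusterPt c atTop u) {V : Set M}
    (hV : IsIsolating m f c V) : ∀ᶠ t in atTop, u t ∈ V := by
  obtain ⟨δ, hδ, hgrad⟩ := exists_le_gradSq hf g (K := frontier V)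
    (hV.isClosed.isCompact.of_isClosed_subset isClosed_frontier hV.isClosed.frontier_subset)
    fun x hx hcrit ↦
    hx.2 (hV.eq_of_isCritical x (hV.isClosed.frontier_subset hx) hcrit ▸
      mem_interior_iff_mem_nhds.2 hV.mem_nhds)
  obtain ⟨R, hR⟩ := eventually_atTop.1
    ((hu.tendsto_gradSq hf hc).eventually (eventually_lt_nhds hδ))
  obtain ⟨t, ht, htR⟩ := ((h.frequently (interior_mem_nhds.2 hV.mem_nhds)).and_eventually
    (eventually_ge_atTop R)).exists
  have hsub : u '' Ici R ⊆ interior V := by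
    refine (isPreconnected_Ici.image u hc.continuousOn).subset_left_of_subset_union
      isOpen_interior hV.isClosed.isOpen_compl (disjoint_compl_right.mono_left interior_subset)
      ?_ ⟨u t, ⟨t, htR, rfl⟩, ht⟩
    rintro _ ⟨τ, hτ, rfl⟩
    by_contra! hn
    rw [mem_union, mem_compl_iff, not_or, not_not] at hn
    exact (hR τ hτ).not_ge (hgrad _ ⟨subset_closure hn.2, hn.1⟩)
  exact (eventually_ge_atTop R).mono fun τ hτ ↦ interior_subset (hsub ⟨τ, hτ, rfl⟩)

theorem exists_tendsto [RegularSpace M] (hf : IsMorse m f) (hu : FlowsAfter g f T u)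
    (hc : Continuous u) : ∃ c, IsCritical m f c ∧ Tendsto u atTop (𝓝 c) := by
  obtain ⟨c, hcl⟩ := exists_clusterPt_of_compactSpace (map u atTop)
  have hcrit := hu.isCritical_of_mapClusterPt hf.smooth hc hcl
  refine ⟨c, hcrit, fun U hU ↦ ?_⟩
  obtain ⟨V, hVU, hV⟩ := hf.exists_isIsolating hcrit hU
  exact (hu.eventually_mem_of_isIsolating hf.smooth hc hcl hV).mono fun t ht ↦ hVU ht

theorem memLp_two (hf : MDifferentiable 𝓘(ℝ, Model m) 𝓘(ℝ, ℝ) f) (hu : FlowsAfter g f T u)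
    (hc : Continuous u) {b : ℝ → ℝ} (hb : Continuous b) {C : ℝ}
    (hle : ∀ᶠ t in atTop, b t ^ 2 ≤ C * gradSq g f (u t)) :
    MemLp b 2 (volume.restrict (Ici 0)) := by
  rw [memLp_two_iff_integrable_sq hb.aestronglyMeasurable]
  obtain ⟨R, hR, hTR⟩ := ((eventually_forall_ge_atTop.2 hle).and (eventually_ge_atTop T)).exists
  have htail : IntegrableOn (fun t ↦ b t ^ 2) (Ioi R) :=
    Integrable.mono' (((hu.mono hTR).integrableOn_gradSq hf hc).const_mul C)
      (hb.pow 2).aestronglyMeasurable <| (ae_restrict_mem measurableSet_Ioi).mono fun t ht ↦ by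
        rw [Real.norm_eq_abs, abs_sq]
        exact hR t (mem_Ioi.1 ht).le
  have hhead : IntegrableOn (fun t ↦ b t ^ 2) (Icc 0 R) :=
    (hb.pow 2).continuousOn.integrableOn_compact isCompact_Icc
  exact (hhead.union htail).mono_set Ici_subset_Icc_union_Ioi

theorem memLp_sub (hf : IsMorse m f) (hu : FlowsAfter g f T u) (hc : Continuous u)
    (hcrit : IsCritical m f c) (hlim : Tendsto u atTop (𝓝 c))
    (hφ : ContMDiff 𝓘(ℝ, Model m) 𝓘(ℝ, ℝ) ∞ φ) :
    MemLp (fun t ↦ φ (u t) - φ c) 2 (volume.restrict (Ici 0)) := by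
  obtain ⟨C, hC⟩ := hf.eventually_sub_sq_le g hcrit hφ
  exact hu.memLp_two (hf.smooth.mdifferentiable (by simp)) hc
    ((hφ.continuous.comp hc).sub continuous_const) (hlim.eventually hC)

theorem memLp_deriv (hf : MDifferentiable 𝓘(ℝ, Model m) 𝓘(ℝ, ℝ) f) (hu : FlowsAfter g f T u)
    (hc : Continuous u) (hφ : ContMDiff 𝓘(ℝ, Model m) 𝓘(ℝ, ℝ) ∞ φ)
    (hd : Continuous (deriv fun t ↦ φ (u t))) :
    MemLp (deriv fun t ↦ φ (u t)) 2 (volume.restrict (Ici 0)) := by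
  obtain ⟨C, -, hC⟩ := exists_inner_gradient_sq_le g f hφ
  refine hu.memLp_two hf hc hd (C := C) ((eventually_gt_atTop T).mono fun t ht ↦ ?_)
  rw [hu.deriv_comp hφ ht, neg_sq]
  exact hC _

end FlowsAfter

end HalfLine

theorem eLpNorm_two_eq_rpow_lintegral_sq {α : Type*} [MeasurableSpace α] (b : α → ℝ)
    (μ : Measure α) : eLpNorm b 2 μ = (∫⁻ t, ENNReal.ofReal (b t ^ 2) ∂μ) ^ (1 / 2 : ℝ) := by
  rw [eLpNorm_eq_lintegral_rpow_enorm_toReal two_ne_zero ENNReal.ofNat_ne_top,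
    ENNReal.toReal_ofNat]
  congr 1
  refine lintegral_congr fun t ↦ ?_
  rw [← ofReal_norm, ENNReal.ofReal_rpow_of_nonneg (norm_nonneg _) zero_le_two, Real.rpow_two,
    Real.norm_eq_abs, sq_abs]

theorem lintegral_Iic_eq_lintegral_Ici_comp_neg (F : ℝ → ℝ≥0∞) :
    ∫⁻ t in Iic 0, F t = ∫⁻ t in Ici 0, F (-t) := by
  rw [← (Measure.measurePreserving_neg (volume : Measure ℝ)).setLIntegral_comp_preimage_emb
    (MeasurableEquiv.neg ℝ).measurableEmbedding F (Iic 0)]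
  simp

theorem tendsto_eLpNorm_two_of_halves {b : ℕ → ℝ → ℝ}
    (hpos : Tendsto (fun ν ↦ ∫⁻ t in Ici 0, ENNReal.ofReal (b ν t ^ 2)) atTop (𝓝 0))
    (hneg : Tendsto (fun ν ↦ ∫⁻ t in Ici 0, ENNReal.ofReal (b ν (-t) ^ 2)) atTop (𝓝 0)) :
    Tendsto (fun ν ↦ eLpNorm (b ν) 2 volume) atTop (𝓝 0) := by
  have hline : Tendsto (fun ν ↦ ∫⁻ t, ENNReal.ofReal (b ν t ^ 2)) atTop (𝓝 0) := by
    refine tendsto_of_tendsto_of_tendsto_of_le_of_le tendsto_const_nhds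
      (by simpa using hpos.add hneg) (fun _ ↦ zero_le) fun ν ↦ ?_
    rw [← lintegral_Iic_eq_lintegral_Ici_comp_neg fun t ↦ ENNReal.ofReal (b ν t ^ 2),
      ← setLIntegral_univ, ← Ici_union_Iic (a := (0 : ℝ))]
    exact lintegral_union_le _ _ _
  have hsqrt := (ENNReal.continuous_rpow_const (y := (1 / 2 : ℝ))).tendsto 0
  rw [ENNReal.zero_rpow_of_pos (by norm_num)] at hsqrt
  simp_rw [eLpNorm_two_eq_rpow_lintegral_sq]
  exact hsqrt.comp hline

theorem TendstoContinuously.tendsto_lintegral_sq_sub {b : ℕ → ℝ → ℝ} {b₀ : ℝ → ℝ}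
    (h : TendstoContinuously b b₀ atTop) (hb : ∀ ν, Measurable (b ν)) {K : Set ℝ}
    (hK : IsCompact K) :
    Tendsto (fun ν ↦ ∫⁻ t in K, ENNReal.ofReal ((b ν t - b₀ t) ^ 2)) atTop (𝓝 0) := by
  have hb₀ : Continuous b₀ := h.continuous
  have hsub : TendstoContinuously (fun ν t ↦ b ν t - b₀ t) (fun _ ↦ (0 : ℝ)) atTop := fun t ↦ by
    simpa using (h t).sub ((hb₀.tendsto t).comp tendsto_snd)
  have hbound : ∀ᶠ ν in atTop, MapsTo (fun t ↦ b ν t - b₀ t) K (Metric.ball 0 1) :=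
    hsub.eventually_forall_mem hK Metric.isOpen_ball
      fun _ _ ↦ Metric.mem_ball_self one_pos
  have hlim := tendsto_lintegral_filter_of_dominated_convergence (μ := volume.restrict K)
    (F := fun ν t ↦ ENNReal.ofReal ((b ν t - b₀ t) ^ 2)) (f := fun _ ↦ 0) (l := atTop) (fun _ ↦ 1)
    (Eventually.of_forall fun ν ↦ (((hb ν).sub hb₀.measurable).pow_const 2).ennreal_ofReal)
    ?_ (by simpa using hK.measure_lt_top.ne) (Eventually.of_forall fun t ↦ ?_)
  · simpa using hlim
  · filter_upwards [hbound] with ν hν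
    filter_upwards [ae_restrict_mem hK.measurableSet] with t ht
    have hlt := hν ht
    rw [mem_ball_zero_iff, Real.norm_eq_abs] at hlt
    exact ENNReal.ofReal_le_one.2 ((sq_le_one_iff_abs_le_one _).2 hlt.le)
  · simpa using ENNReal.tendsto_ofReal ((hsub.tendsto t).pow 2)

section HalfLine

variable {m : ℕ} {M : Type*} [TopologicalSpace M] [ChartedSpace (Model m) M]
  [IsManifold 𝓘(ℝ, Model m) ∞ M] [CompactSpace M] {f φ : M → ℝ} {g : Metric m M} {T R : ℝ} {c : M}

theorem FlowsAfter.lintegral_sq_sub_le (hf : ContMDiff 𝓘(ℝ, Model m) 𝓘(ℝ, ℝ) ∞ f) {u w : ℝ → M}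
    (hu : FlowsAfter g f R u) (huc : Continuous u) (hulim : Tendsto u atTop (𝓝 c))
    (hw : FlowsAfter g f R w) (hwc : Continuous w) (hwlim : Tendsto w atTop (𝓝 c))
    {b b₀ : ℝ → ℝ} {C : ℝ} (hb : ∀ t > R, b t ^ 2 ≤ C * gradSq g f (u t))
    (hb₀ : ∀ t > R, b₀ t ^ 2 ≤ C * gradSq g f (w t)) :
    ∫⁻ t in Ioi R, ENNReal.ofReal ((b t - b₀ t) ^ 2) ≤
      ENNReal.ofReal (2 * C) *
        (ENNReal.ofReal (f (u R) - f c) + ENNReal.ofReal (f (w R) - f c)) := by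
  have hdiff := hf.mdifferentiable (by simp)
  have hmeas : Measurable fun t ↦ ENNReal.ofReal (gradSq g f (u t)) :=
    ((contMDiff_gradSq g hf).continuous.comp huc).measurable.ennreal_ofReal
  rw [← hu.lintegral_gradSq hdiff huc hulim, ← hw.lintegral_gradSq hdiff hwc hwlim,
    ← lintegral_add_left hmeas, ← lintegral_const_mul' _ _ ENNReal.ofReal_ne_top]
  refine setLIntegral_mono' measurableSet_Ioi fun t ht ↦ ?_
  rw [← ENNReal.ofReal_add (gradSq_nonneg g f _) (gradSq_nonneg g f _),
    ← ENNReal.ofReal_mul' (add_nonneg (gradSq_nonneg g f _) (gradSq_nonneg g f _))]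
  refine ENNReal.ofReal_le_ofReal ?_
  nlinarith [hb t ht, hb₀ t ht, sq_nonneg (b t + b₀ t)]

/-- On a compact interval the convergence is uniform, and the tails are controlled by the energies
`f (u ν R) - f c` and `f (w R) - f c`, which are small for `R` large because the `u ν` and `w` have
the same limit. -/
theorem FlowsAfter.tendsto_lintegral_sq_sub [RegularSpace M]
    (hf : ContMDiff 𝓘(ℝ, Model m) 𝓘(ℝ, ℝ) ∞ f) {u : ℕ → ℝ → M} {w : ℝ → M}
    (hu : ∀ ν, FlowsAfter g f T (u ν)) (huc : ∀ ν, Continuous (u ν))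
    (hulim : ∀ ν, Tendsto (u ν) atTop (𝓝 c)) (hw : FlowsAfter g f T w)
    (hwlim : Tendsto w atTop (𝓝 c)) (h : TendstoContinuously u w atTop)
    {b : ℕ → ℝ → ℝ} {b₀ : ℝ → ℝ} (hb : TendstoContinuously b b₀ atTop)
    (hbm : ∀ ν, Measurable (b ν)) {C : ℝ}
    (hle : ∀ᶠ ν in atTop, ∀ t ≥ R, b ν t ^ 2 ≤ C * gradSq g f (u ν t)) :
    Tendsto (fun ν ↦ ∫⁻ t in Ici 0, ENNReal.ofReal ((b ν t - b₀ t) ^ 2)) atTop (𝓝 0) := by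
  have hle₀ : ∀ t ≥ R, b₀ t ^ 2 ≤ C * gradSq g f (w t) := fun t ht ↦
    le_of_tendsto_of_tendsto ((hb.tendsto t).pow 2)
      (((h.postcomp (contMDiff_gradSq g hf).continuous).tendsto t).const_mul C)
      (hle.mono fun ν hν ↦ hν t ht)
  set E : ℝ → ℝ → ℝ≥0∞ := fun x y ↦
    ENNReal.ofReal (2 * C) * (ENNReal.ofReal (x - f c) + ENNReal.ofReal (y - f c)) with hE
  have hEc : Continuous fun z : ℝ × ℝ ↦ E z.1 z.2 :=
    (ENNReal.continuous_const_mul ENNReal.ofReal_ne_top).comp <|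
      (ENNReal.continuous_ofReal.comp (by fun_prop)).add (ENNReal.continuous_ofReal.comp
        (by fun_prop))
  have hfw : Tendsto (fun t ↦ E (f (w t)) (f (w t))) atTop (𝓝 0) := by
    have hlim := (hf.continuous.tendsto c).comp hwlim
    simpa [hE, Function.comp_def] using (hEc.tendsto (f c, f c)).comp (hlim.prodMk_nhds hlim)
  refine ENNReal.tendsto_nhds_zero.2 fun ε hε ↦ ?_
  have hε₂ : 0 < ε / 2 := ENNReal.half_pos hε.ne'
  obtain ⟨S, hS, hRS, hTS⟩ := ((hfw.eventually (eventually_lt_nhds hε₂)).and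
    ((eventually_ge_atTop R).and (eventually_ge_atTop T))).exists
  have hfu : ∀ᶠ ν in atTop, E (f (u ν S)) (f (w S)) < ε / 2 :=
    ((hEc.tendsto (f (w S), f (w S))).comp (((h.postcomp hf.continuous).tendsto S).prodMk_nhds
      tendsto_const_nhds)).eventually (eventually_lt_nhds hS)
  filter_upwards [hfu, hle, ENNReal.tendsto_nhds_zero.1
    (hb.tendsto_lintegral_sq_sub hbm (isCompact_Icc (a := 0) (b := S))) _ hε₂] with ν htail hν hhead
  calc _ ≤ _ := lintegral_mono_set Ici_subset_Icc_union_Ioi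
    _ ≤ _ := lintegral_union_le _ _ _
    _ ≤ ε / 2 + ε / 2 := add_le_add hhead <| le_trans
        (((hu ν).mono hTS).lintegral_sq_sub_le hf (huc ν) (hulim ν) (hw.mono hTS) h.continuous
          hwlim (fun t ht ↦ hν t (hRS.trans ht.le)) fun t ht ↦ hle₀ t (hRS.trans ht.le)) htail.le
    _ = ε := ENNReal.add_halves ε

theorem FlowsAfter.tendsto_lintegral_sq_sub_comp [RegularSpace M] (hf : IsMorse m f)
    (hcrit : IsCritical m f c) {u : ℕ → ℝ → M} {w : ℝ → M}
    (hu : ∀ ν, FlowsAfter g f T (u ν)) (huc : ∀ ν, Continuous (u ν))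
    (hulim : ∀ ν, Tendsto (u ν) atTop (𝓝 c)) (hw : FlowsAfter g f T w)
    (hwlim : Tendsto w atTop (𝓝 c)) (h : TendstoContinuously u w atTop) {V : Set M}
    (hV : IsIsolating m f c V) (hstay : ∀ᶠ ν in atTop, ∀ t ≥ R, u ν t ∈ V)
    (hφ : ContMDiff 𝓘(ℝ, Model m) 𝓘(ℝ, ℝ) ∞ φ) :
    Tendsto (fun ν ↦ ∫⁻ t in Ici 0, ENNReal.ofReal ((φ (u ν t) - φ (w t)) ^ 2)) atTop (𝓝 0) := by
  obtain ⟨C, -, hle⟩ := hf.exists_sub_sq_le g hcrit hV hφ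
  simpa using FlowsAfter.tendsto_lintegral_sq_sub hf.smooth hu huc hulim hw hwlim h
    (b := fun ν t ↦ φ (u ν t) - φ c) (h.postcomp (hφ.continuous.sub continuous_const))
    (fun ν ↦ ((hφ.continuous.comp (huc ν)).sub continuous_const).measurable)
    (hstay.mono fun ν hν t ht ↦ hle _ (hν t ht))

theorem FlowsAfter.tendsto_lintegral_sq_sub_deriv [RegularSpace M]
    (hf : ContMDiff 𝓘(ℝ, Model m) 𝓘(ℝ, ℝ) ∞ f) {u : ℕ → ℝ → M} {w : ℝ → M}
    (hu : ∀ ν, FlowsAfter g f T (u ν)) (huc : ∀ ν, Continuous (u ν))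
    (hulim : ∀ ν, Tendsto (u ν) atTop (𝓝 c)) (hw : FlowsAfter g f T w)
    (hwlim : Tendsto w atTop (𝓝 c)) (h : TendstoContinuously u w atTop)
    (hφ : ContMDiff 𝓘(ℝ, Model m) 𝓘(ℝ, ℝ) ∞ φ)
    (hderiv : TendstoContinuously (fun ν ↦ deriv fun t ↦ φ (u ν t)) (deriv fun t ↦ φ (w t)) atTop) :
    Tendsto (fun ν ↦ ∫⁻ t in Ici 0, ENNReal.ofReal
      ((deriv (fun t ↦ φ (u ν t)) t - deriv (fun t ↦ φ (w t)) t) ^ 2)) atTop (𝓝 0) := by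
  obtain ⟨C, -, hle⟩ := exists_inner_gradient_sq_le g f hφ
  refine FlowsAfter.tendsto_lintegral_sq_sub hf hu huc hulim hw hwlim h hderiv
    (fun ν ↦ measurable_deriv _) (R := T + 1) (C := C) (Eventually.of_forall fun ν t ht ↦ ?_)
  rw [(hu ν).deriv_comp hφ (by linarith), neg_sq]
  exact hle _

end HalfLine

section Reparametrization

variable {m : ℕ} {M : Type*} [TopologicalSpace M] [ChartedSpace (Model m) M] {u : ℝ → M} {t : ℝ}

theorem IsTrajectoryAt.comp_add {Y : (x : M) → TangentSpace 𝓘(ℝ, Model m) x} {a : ℝ}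
    (hu : IsTrajectoryAt (fun _ ↦ Y) u (t + a)) :
    IsTrajectoryAt (fun _ ↦ Y) (fun τ ↦ u (τ + a)) t := by
  have hadd : HasMFDerivAt 𝓘(ℝ, ℝ) 𝓘(ℝ, ℝ) (fun τ : ℝ ↦ τ + a) t (1 : ℝ →L[ℝ] ℝ) :=
    ((hasFDerivAt_id t).add_const a).hasMFDerivAt
  exact HasMFDerivAt.comp t (show HasMFDerivAt _ _ u (t + a) _ from hu) hadd

theorem IsTrajectoryAt.comp_neg {Y : (x : M) → TangentSpace 𝓘(ℝ, Model m) x}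
    (hu : IsTrajectoryAt (fun _ ↦ Y) u (-t)) :
    IsTrajectoryAt (fun _ x ↦ -Y x) (fun τ ↦ u (-τ)) t := by
  have hneg : HasMFDerivAt 𝓘(ℝ, ℝ) 𝓘(ℝ, ℝ) (fun τ : ℝ ↦ -τ) t (-(1 : ℝ →L[ℝ] ℝ)) :=
    (hasFDerivAt_id t).neg.hasMFDerivAt
  have hsmul : ∀ v : Model m, ((1 : ℝ →L[ℝ] ℝ).smulRight v).comp (-(1 : ℝ →L[ℝ] ℝ)) =
      (1 : ℝ →L[ℝ] ℝ).smulRight (-v) := fun v ↦ ContinuousLinearMap.ext_ring (by simp)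
  have hcomp := HasMFDerivAt.comp t (show HasMFDerivAt _ _ u (-t) _ from hu) hneg
  unfold IsTrajectoryAt
  exact (hsmul (Y (u (-t)))).symm ▸ hcomp

variable {f : M → ℝ} {c : M}

theorem isCritical_neg : IsCritical m (-f) c ↔ IsCritical m f c := by
  have h : mfderiv 𝓘(ℝ, Model m) 𝓘(ℝ, ℝ) (-f) c = -mfderiv 𝓘(ℝ, Model m) 𝓘(ℝ, ℝ) f c :=
    mfderiv_neg
  rw [IsCritical, IsCritical, h]
  exact neg_eq_zero

theorem hessian_neg (f : M → ℝ) (c : M) : hessian m (-f) c = -hessian m f c := by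
  have h : fderiv ℝ ((-f) ∘ (extChartAt 𝓘(ℝ, Model m) c).symm) =
      -fderiv ℝ (f ∘ (extChartAt 𝓘(ℝ, Model m) c).symm) := funext fun _ ↦ fderiv_neg
  rw [hessian, hessian, h]
  exact fderiv_neg

theorem IsMorse.neg (hf : IsMorse m f) : IsMorse m (-f) where
  smooth := hf.smooth.neg
  nondegenerate p hp v hv := hf.nondegenerate p (isCritical_neg.1 hp) v fun w ↦ by
    have hvw := hv w
    rw [hessian_neg] at hvw
    exact neg_eq_zero.1 hvw

variable [IsManifold 𝓘(ℝ, Model m) ∞ M] {g : Metric m M}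

theorem IsTrajectoryAt.reverse (hu : IsTrajectoryAt (fun _ x ↦ -gradient g f x) u (-t)) :
    IsTrajectoryAt (fun _ x ↦ -gradient g (-f) x) (fun τ ↦ u (-τ)) t := by
  simp_rw [gradient_neg]
  exact hu.comp_neg

theorem IsFlowLine.reverse (hu : IsFlowLine (fun _ ↦ g) (fun _ ↦ f) u) :
    IsFlowLine (fun _ ↦ g) (fun _ ↦ -f) (fun t ↦ u (-t)) := fun t ↦
  IsTrajectoryAt.reverse (hu (-t))

end Reparametrization

section FlowLines

variable {m : ℕ} {M : Type*} [TopologicalSpace M] [ChartedSpace (Model m) M]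
  [IsManifold 𝓘(ℝ, Model m) ∞ M]

namespace IsFlowLine

theorem continuous {g : ℝ → Metric m M} {h : ℝ → M → ℝ} {u : ℝ → M} (hu : IsFlowLine g h u) :
    Continuous u :=
  continuous_iff_continuousAt.2 fun t ↦ (hu t).continuousAt

variable {f : M → ℝ} {g : Metric m M} {w : ℝ → M} {a b : M}

theorem flowsAfter (hw : IsFlowLine (fun _ ↦ g) (fun _ ↦ f) w) (T : ℝ) : FlowsAfter g f T w :=
  fun t _ ↦ hw t

theorem antitone (hf : MDifferentiable 𝓘(ℝ, Model m) 𝓘(ℝ, ℝ) f)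
    (hw : IsFlowLine (fun _ ↦ g) (fun _ ↦ f) w) : Antitone fun t ↦ f (w t) :=
  antitone_of_hasDerivAt_nonpos (fun t ↦ (hw.flowsAfter (t - 1)).hasDerivAt hf (sub_one_lt t))
    fun t ↦ neg_nonpos.2 (gradSq_nonneg g f (w t))

theorem lt_of_tendsto (hf : MDifferentiable 𝓘(ℝ, Model m) 𝓘(ℝ, ℝ) f)
    (hw : IsFlowLine (fun _ ↦ g) (fun _ ↦ f) w) {t : ℝ} (ht : ¬ IsCritical m f (w t))
    (ha : Tendsto w atBot (𝓝 a)) (hb : Tendsto w atTop (𝓝 b)) : f b < f a := by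
  by_contra! hle
  have hconst : ∀ τ, f (w τ) = f a := fun τ ↦ le_antisymm
    ((hw.antitone hf).ge_of_tendsto ((hf.continuous.tendsto a).comp ha) τ)
    (hle.trans ((hw.antitone hf).le_of_tendsto ((hf.continuous.tendsto b).comp hb) τ))
  have hderiv := (hw.flowsAfter (t - 1)).hasDerivAt hf (sub_one_lt t)
  simp_rw [hconst] at hderiv
  exact ht ((gradSq_eq_zero_iff g f _).1
    (neg_eq_zero.1 (hderiv.unique (hasDerivAt_const t (f a)))))

theorem exists_tendsto_atBot [CompactSpace M] [RegularSpace M] (hf : IsMorse m f)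
    (hw : IsFlowLine (fun _ ↦ g) (fun _ ↦ f) w) :
    ∃ a, IsCritical m f a ∧ Tendsto w atBot (𝓝 a) := by
  obtain ⟨a, ha, hlim⟩ :=
    (hw.reverse.flowsAfter 0).exists_tendsto hf.neg (hw.continuous.comp continuous_neg)
  refine ⟨a, isCritical_neg.1 ha, ?_⟩
  simpa [Function.comp_def] using hlim.comp tendsto_neg_atBot_atTop

end IsFlowLine

end FlowLines

section Chain

variable {m : ℕ} {M : Type*} [TopologicalSpace M] [ChartedSpace (Model m) M]
  [IsManifold 𝓘(ℝ, Model m) ∞ M] {f : M → ℝ} {g : Metric m M} {u : ℕ → ℝ → M} {l : Filter ℝ}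
  {a b c q : M} {w : ℝ → M} {r : ℕ → ℝ}

/-- The curve `w` is a non-constant flow line of `(f, g)` from `a` to `b` to which the `u ν`
converge near the times `r ν`. These times tend to `l`, which is `atTop` for pieces breaking off at
the positive end and `atBot` for the negative end; the condition is stated for `t + r ν`, locally
uniformly in `t`, so that it makes sense for every filter. -/
structure IsShiftLimit (g : Metric m M) (f : M → ℝ) (u : ℕ → ℝ → M) (l : Filter ℝ) (a b : M)
    (w : ℝ → M) (r : ℕ → ℝ) : Prop where
  isFlowLine : IsFlowLine (fun _ ↦ g) (fun _ ↦ f) w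
  tendsto_atBot : Tendsto w atBot (𝓝 a)
  tendsto_atTop : Tendsto w atTop (𝓝 b)
  nonconstant : ∀ x, w ≠ fun _ ↦ x
  tendsto_shift : ∀ t, Tendsto (fun y : ℕ × ℝ ↦ y.2 + r y.1) (atTop ×ˢ 𝓝 t) l
  tendstoContinuously : TendstoContinuously (fun ν t ↦ u ν (t + r ν)) w atTop

theorem IsShiftLimit.subseq (h : IsShiftLimit g f u l a b w r) {j : ℕ → ℕ} (hj : StrictMono j) :
    IsShiftLimit g f (fun ν ↦ u (j ν)) l a b w (fun ν ↦ r (j ν)) :=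
  { h with
    tendsto_shift t := (h.tendsto_shift t).comp (hj.tendsto_atTop.prodMap tendsto_id)
    tendstoContinuously := h.tendstoContinuously.comp_index hj.tendsto_atTop }

theorem IsShiftLimit.reverse (h : IsShiftLimit g (-f) (fun ν t ↦ u ν (-t)) atTop a b w r) :
    IsShiftLimit g f u atBot b a (fun t ↦ w (-t)) (fun ν ↦ -r ν) where
  isFlowLine := neg_neg f ▸ h.isFlowLine.reverse
  tendsto_atBot := h.tendsto_atTop.comp tendsto_neg_atBot_atTop
  tendsto_atTop := h.tendsto_atBot.comp tendsto_neg_atTop_atBot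
  nonconstant x hx := h.nonconstant x (funext fun t ↦ by simpa using congrFun hx (-t))
  tendsto_shift t := by
    simpa [Function.comp_def, add_comm] using tendsto_neg_atTop_atBot.comp
      ((h.tendsto_shift (-t)).comp (tendsto_id.prodMap (continuous_neg.tendsto t)))
  tendstoContinuously := by
    simpa [add_comm] using h.tendstoContinuously.precomp continuous_neg

/-- A chain of `length` flow lines of `(f, g)` breaking off from the sequence `u` at times tending
to `l`, through the critical points `point 0 = c, …, point length = q`. -/
structure Chain (g : Metric m M) (f : M → ℝ) (u : ℕ → ℝ → M) (l : Filter ℝ) (c q : M) where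
  length : ℕ
  point : ℕ → M
  curve : ℕ → ℝ → M
  shift : ℕ → ℕ → ℝ
  point_zero : point 0 = c
  point_length : point length = q
  isCritical : ∀ k ≤ length, IsCritical m f (point k)
  isShiftLimit : ∀ k < length,
    IsShiftLimit g f u l (point k) (point (k + 1)) (curve k) (shift k)

namespace Chain

variable (g u l) in
/-- The chain of length zero at a critical point. -/
def nil (hc : IsCritical m f c) : Chain g f u l c c where
  length := 0
  point _ := c
  curve _ _ := c
  shift _ _ := 0
  point_zero := rfl
  point_length := rfl
  isCritical _ _ := hc
  isShiftLimit _ hk := absurd hk (Nat.not_lt_zero _)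

/-- A chain with one more flow line in front. -/
def cons (C : Chain g f u l b q) (ha : IsCritical m f a) (h : IsShiftLimit g f u l a b w r) :
    Chain g f u l a q where
  length := C.length + 1
  point k := k.casesOn a C.point
  curve k := k.casesOn w C.curve
  shift k := k.casesOn r C.shift
  point_zero := rfl
  point_length := C.point_length
  isCritical
    | 0, _ => ha
    | k + 1, hk => C.isCritical k (Nat.le_of_succ_le_succ hk)
  isShiftLimit
    | 0, _ => show IsShiftLimit g f u l a (C.point 0) w r from C.point_zero.symm ▸ h
    | k + 1, hk => C.isShiftLimit k (Nat.lt_of_succ_lt_succ hk)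

/-- The chain of a subsequence. -/
def subseq (C : Chain g f u l c q) {j : ℕ → ℕ} (hj : StrictMono j) :
    Chain g f (fun ν ↦ u (j ν)) l c q :=
  { C with
    shift k ν := C.shift k (j ν)
    isShiftLimit k hk := (C.isShiftLimit k hk).subseq hj }

/-- Reversing time turns a chain of flow lines of `-f` into a chain of flow lines of `f`. -/
def reverse (C : Chain g (-f) (fun ν t ↦ u ν (-t)) atTop c q) : Chain g f u atBot q c where
  length := C.length
  point k := C.point (C.length - k)
  curve k t := C.curve (C.length - 1 - k) (-t)
  shift k ν := -C.shift (C.length - 1 - k) ν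
  point_zero := C.point_length
  point_length := by rw [Nat.sub_self, C.point_zero]
  isCritical k _ := isCritical_neg.1 (C.isCritical _ (Nat.sub_le _ _))
  isShiftLimit k hk := by
    have h := (C.isShiftLimit (C.length - 1 - k) (by omega)).reverse
    rw [show C.length - 1 - k + 1 = C.length - k by omega] at h
    rwa [show C.length - (k + 1) = C.length - 1 - k by omega]

theorem eq_of_length_eq_zero (C : Chain g f u l c q) (h : C.length = 0) : c = q :=
  C.point_zero.symm.trans ((congrArg C.point h).symm.trans C.point_length)

end Chain

end Chain

section Exit

variable {X : Type*} [TopologicalSpace X] {O : Set X} {R : ℝ}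

theorem exists_exit_time {γ : ℝ → X} (hγ : Continuous γ) (hO : IsOpen O)
    (h : ∃ t ≥ R, γ t ∉ O) : ∃ τ ≥ R, γ τ ∉ O ∧ ∀ t, R ≤ t → t < τ → γ t ∈ O := by
  have hclosed : IsClosed (Ici R ∩ γ ⁻¹' Oᶜ) :=
    isClosed_Ici.inter (hO.isClosed_compl.preimage hγ)
  have hbdd : BddBelow (Ici R ∩ γ ⁻¹' Oᶜ) := ⟨R, fun t ht ↦ ht.1⟩
  have hmem := hclosed.csInf_mem h hbdd
  refine ⟨_, hmem.1, hmem.2, fun t hRt ht ↦ ?_⟩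
  by_contra hout
  exact notMem_of_lt_csInf ht hbdd ⟨hRt, hout⟩

theorem TendstoContinuously.tendsto_exit_time {ι : Type*} {p : Filter ι} {F : ι → ℝ → X}
    {w : ℝ → X} (h : TendstoContinuously F w p) (hO : IsOpen O) (hw : ∀ t ≥ R, w t ∈ O)
    {τ : ι → ℝ} (hτ : ∀ i, R ≤ τ i) (hout : ∀ i, F i (τ i) ∉ O) : Tendsto τ p atTop := by
  refine tendsto_atTop.2 fun A ↦ ?_
  filter_upwards [h.eventually_forall_mem (isCompact_Icc (a := R) (b := A)) hO fun t ht ↦ hw t ht.1]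
    with i hi
  by_contra! hA
  exact hout i (hi ⟨hτ i, hA.le⟩)

theorem TendstoContinuously.exists_subseq_exit_time {F : ℕ → ℝ → X} {w : ℝ → X}
    (h : TendstoContinuously F w atTop) (hF : ∀ ν, Continuous (F ν)) (hO : IsOpen O)
    (hw : ∀ t ≥ R, w t ∈ O) (hexit : ∃ᶠ ν in atTop, ∃ t ≥ R, F ν t ∉ O) :
    ∃ i : ℕ → ℕ, StrictMono i ∧ ∃ τ : ℕ → ℝ, Tendsto τ atTop atTop ∧
      ∀ ν, F (i ν) (τ ν) ∉ O ∧ ∀ t, R ≤ t → t < τ ν → F (i ν) t ∈ O := by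
  obtain ⟨i, hi, hout⟩ := extraction_of_frequently_atTop hexit
  choose τ hRτ hτ using fun ν ↦ exists_exit_time (hF (i ν)) hO (hout ν)
  exact ⟨i, hi, τ, (h.comp_index hi.tendsto_atTop).tendsto_exit_time hO hw hRτ fun ν ↦ (hτ ν).1, hτ⟩

end Exit

section Breaking

variable {m : ℕ} {M : Type*} [TopologicalSpace M] [ChartedSpace (Model m) M]
  [IsManifold 𝓘(ℝ, Model m) ∞ M] [T2Space M] [CompactSpace M] {E : Type*} [MetricSpace E]
  {e : M → E} {K : NNReal} {T R : ℝ} {f : M → ℝ} {g : Metric m M} {u : ℕ → ℝ → M} {w : ℝ → M}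
  {r : ℕ → ℝ} {c q : M} {V : Set M}

theorem exists_subseq_tendstoContinuously_shift (hf : ContMDiff 𝓘(ℝ, Model m) 𝓘(ℝ, ℝ) ∞ f)
    (he : IsInducing e) (hLip : ∀ ν, LipschitzWith K fun t ↦ e (u ν t))
    (hu : ∀ ν, FlowsAfter g f T (u ν)) (hr : Tendsto r atTop atTop) :
    ∃ j : ℕ → ℕ, StrictMono j ∧ ∃ w, IsFlowLine (fun _ ↦ g) (fun _ ↦ f) w ∧
      TendstoContinuously (fun ν t ↦ u (j ν) (t + r (j ν))) w atTop := by
  obtain ⟨j, hj, w, hw⟩ := exists_subseq_tendstoContinuously he (K := K)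
    (u := fun ν t ↦ u ν (t + r ν)) fun ν x y ↦ by simpa using hLip ν (x + r ν) (y + r ν)
  refine ⟨j, hj, w, fun t ↦ ?_, hw⟩
  refine hw.isTrajectoryAt (s := fun _ ↦ 0) (isSmoothFieldOn_const_neg_gradient g hf)
    uniqueDiffOn_univ (tendsto_const_nhds.mono_right (nhdsWithin_univ _).ge) (mem_univ _) ?_
  have hshift : Tendsto (fun y : ℕ × ℝ ↦ y.2 + r (j y.1)) (atTop ×ˢ 𝓝 t) atTop :=
    tendsto_snd.add_atTop ((hr.comp hj.tendsto_atTop).comp tendsto_fst)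
  exact (hshift.eventually_gt_atTop T).mono fun y hy ↦ (hu _ _ hy).comp_add

theorem IsIsolating.tendsto_atBot (hV : IsIsolating m f c V) (hf : IsMorse m f)
    (hw : IsFlowLine (fun _ ↦ g) (fun _ ↦ f) w) (hmem : ∀ᶠ t in atBot, w t ∈ V) :
    Tendsto w atBot (𝓝 c) := by
  obtain ⟨a, ha, hlim⟩ := hw.exists_tendsto_atBot hf
  exact hV.eq_of_isCritical a (hV.isClosed.mem_of_tendsto hlim hmem) ha ▸ hlim

theorem exists_isShiftLimit_of_exit_time (hf : IsMorse m f) (hV : IsIsolating m f c V)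
    (hc : IsCritical m f c) (hw : IsFlowLine (fun _ ↦ g) (fun _ ↦ f) w) (hr : Tendsto r atTop atTop)
    (hlim : TendstoContinuously (fun ν t ↦ u ν (t + r ν)) w atTop)
    (hbefore : ∀ t < 0, ∀ᶠ ν in atTop, u ν (t + r ν) ∈ V)
    (hexit : ∀ ν, u ν (r ν) ∉ interior V) :
    ∃ b, IsCritical m f b ∧ f b < f c ∧ IsShiftLimit g f u atTop c b w r := by
  have hneg : ∀ t < 0, w t ∈ V := fun t ht ↦
    hV.isClosed.mem_of_tendsto (hlim.tendsto t) (hbefore t ht)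
  have hzero : w 0 ∈ V := hV.isClosed.mem_of_tendsto
    ((hw.continuous.tendsto 0).mono_left (nhdsWithin_le_nhds (s := Iio 0)))
    (eventually_mem_nhdsWithin.mono hneg)
  have hout : w 0 ∉ interior V := isOpen_interior.isClosed_compl.mem_of_tendsto (hlim.tendsto 0)
    (Eventually.of_forall fun ν ↦ by simpa only [zero_add, mem_compl_iff] using hexit ν)
  have hcrit : ¬ IsCritical m f (w 0) := fun h ↦
    hout (hV.eq_of_isCritical _ hzero h ▸ mem_interior_iff_mem_nhds.2 hV.mem_nhds)
  have hbot := hV.tendsto_atBot hf hw ((eventually_lt_atBot 0).mono hneg)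
  obtain ⟨b, hb, htop⟩ := (hw.flowsAfter 0).exists_tendsto hf hw.continuous
  refine ⟨b, hb, hw.lt_of_tendsto (hf.smooth.mdifferentiable (by simp)) hcrit hbot htop, hw, hbot,
    htop, fun x hx ↦ ?_, fun t ↦ tendsto_snd.add_atTop (hr.comp tendsto_fst), hlim⟩
  subst hx
  exact hcrit (tendsto_nhds_unique tendsto_const_nhds hbot ▸ hc)

theorem exists_subseq_isShiftLimit (hf : IsMorse m f) (he : IsInducing e)
    (hLip : ∀ ν, LipschitzWith K fun t ↦ e (u ν t)) (hu : ∀ ν, FlowsAfter g f T (u ν))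
    (hr : ∀ᶠ ν in atTop, 0 ≤ r ν) (hw : TendstoContinuously (fun ν t ↦ u ν (t + r ν)) w atTop)
    (hc : IsCritical m f c) (hV : IsIsolating m f c V) (hR : ∀ t ≥ R, w t ∈ interior V)
    (hexit : ∃ᶠ ν in atTop, ∃ t ≥ R, u ν (t + r ν) ∉ interior V) :
    ∃ j : ℕ → ℕ, StrictMono j ∧ ∃ (b : M) (v : ℝ → M) (ρ : ℕ → ℝ), IsCritical m f b ∧ f b < f c ∧
      Tendsto ρ atTop atTop ∧ IsShiftLimit g f (fun ν ↦ u (j ν)) atTop c b v ρ := by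
  obtain ⟨i, hi, τ, hτ, hτV⟩ := hw.exists_subseq_exit_time
    (fun ν ↦ (he.continuous_iff.2 (hLip ν).continuous).comp (continuous_add_const _))
    isOpen_interior hR hexit
  have hρ : Tendsto (fun ν ↦ τ ν + r (i ν)) atTop atTop :=
    tendsto_atTop_mono' _ ((hi.tendsto_atTop.eventually hr).mono fun ν hν ↦
      le_add_of_nonneg_right hν) hτ
  obtain ⟨k, hk, v, hv, hlim⟩ := exists_subseq_tendstoContinuously_shift hf.smooth he
    (fun ν ↦ hLip (i ν)) (fun ν ↦ hu (i ν)) hρ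
  have hbefore : ∀ t < 0, ∀ᶠ ν in atTop, u (i (k ν)) (t + (τ (k ν) + r (i (k ν)))) ∈ V := by
    intro t ht
    filter_upwards [(hτ.comp hk.tendsto_atTop).eventually_ge_atTop (R - t)] with ν hν
    rw [← add_assoc]
    exact interior_subset ((hτV (k ν)).2 _ (sub_le_iff_le_add'.1 hν) (by linarith))
  obtain ⟨b, hb, hlt, hshift⟩ := exists_isShiftLimit_of_exit_time hf hV hc hv
    (hρ.comp hk.tendsto_atTop) hlim hbefore fun ν ↦ (hτV (k ν)).1
  exact ⟨_, hi.comp hk, b, v, _, hb, hlt, hρ.comp hk.tendsto_atTop, hshift⟩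

variable (m f) in
/-- Uniform control of the positive ends of the `u ν`: from some time on, all but finitely many of
them stay in a common neighbourhood of `c` that contains no further critical point. -/
def StaysNear (c : M) (u : ℕ → ℝ → M) : Prop :=
  ∃ V, IsIsolating m f c V ∧ ∃ R, ∀ᶠ ν in atTop, ∀ t ≥ R, u ν t ∈ V

/- Induction on the critical value: if the `u ν` do not stay near the limit `c` of `w`, then their
exit times give a flow line from `c` to a lower critical point, and there are finitely many. -/
theorem exists_chain (hf : IsMorse m f) (he : IsInducing e)
    (hLip : ∀ ν, LipschitzWith K fun t ↦ e (u ν t)) (hu : ∀ ν, FlowsAfter g f T (u ν))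
    (hq : IsCritical m f q) (huq : ∀ ν, Tendsto (u ν) atTop (𝓝 q)) (hr : ∀ᶠ ν in atTop, 0 ≤ r ν)
    (hw : TendstoContinuously (fun ν t ↦ u ν (t + r ν)) w atTop) (hc : IsCritical m f c)
    (hwc : Tendsto w atTop (𝓝 c)) :
    ∃ j : ℕ → ℕ, StrictMono j ∧ ∃ C : Chain g f (fun ν ↦ u (j ν)) atTop c q,
      C.length = 0 → StaysNear m f q fun ν t ↦ u (j ν) (t + r (j ν)) := by
  revert u r w
  apply (hf.finite_critical.wellFoundedOn (r := f ⁻¹'o (· < ·))).induction hc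
  intro c hc ih u w r hLip hu huq hr hw hwc
  obtain ⟨V, -, hV⟩ := hf.exists_isIsolating hc univ_mem
  obtain ⟨R, hR⟩ := eventually_atTop.1 (hwc.eventually (interior_mem_nhds.2 hV.mem_nhds))
  by_cases hexit : ∃ᶠ ν in atTop, ∃ t ≥ R, u ν (t + r ν) ∉ interior V
  · obtain ⟨j, hj, b, v, ρ, hb, hlt, hρ, hv⟩ :=
      exists_subseq_isShiftLimit hf he hLip hu hr hw hc hV hR hexit
    obtain ⟨i, hi, C, -⟩ := ih b hb hlt (fun ν ↦ hLip (j ν)) (fun ν ↦ hu (j ν)) (fun ν ↦ huq (j ν))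
      (hρ.eventually_ge_atTop 0) hv.tendstoContinuously hv.tendsto_atTop
    exact ⟨_, hj.comp hi, C.cons hc (hv.subseq hi), fun h ↦ absurd h (Nat.succ_ne_zero _)⟩
  · have hstay : ∀ᶠ ν in atTop, ∀ t ≥ R, u ν (t + r ν) ∈ V := by
      filter_upwards [not_frequently.1 hexit] with ν hν t ht
      exact interior_subset (by_contra fun h ↦ hν ⟨t, ht, h⟩)
    obtain ⟨ν, hν⟩ := hstay.exists
    have hqV : q ∈ V := hV.isClosed.mem_of_tendsto
      ((huq ν).comp (tendsto_atTop_add_const_right atTop (r ν) tendsto_id))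
      ((eventually_ge_atTop R).mono hν)
    obtain rfl := hV.eq_of_isCritical q hqV hq
    exact ⟨id, strictMono_id, Chain.nil g u atTop hc, fun _ ↦ ⟨V, hV, R, hstay⟩⟩

end Breaking

section Smoothness

variable {m : ℕ} {M : Type*} [TopologicalSpace M] [ChartedSpace (Model m) M]
  [IsManifold 𝓘(ℝ, Model m) ∞ M] {P : Type*} [NormedAddCommGroup P] [NormedSpace ℝ P] {A : Set P}
  {X : P → ℝ → (x : M) → TangentSpace 𝓘(ℝ, Model m) x} {s₀ : P} {w : ℝ → M} {φ : M → ℝ}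

theorem IsSmoothFieldOn.deriv_comp (hX : IsSmoothFieldOn X A) (hA : UniqueDiffOn ℝ A)
    (hs₀ : s₀ ∈ A) (hw : ∀ t, IsTrajectoryAt (X s₀) w t)
    (hφ : ContMDiff 𝓘(ℝ, Model m) 𝓘(ℝ, ℝ) ∞ φ) :
    (deriv fun t ↦ φ (w t)) = fun t ↦ flowDeriv X A φ 1 ((s₀, t), w t) :=
  funext fun t ↦ ((hw t).hasDerivAt_flowDeriv hX hA hs₀ hφ 0).deriv

theorem IsSmoothFieldOn.contDiff_comp (hX : IsSmoothFieldOn X A) (hA : UniqueDiffOn ℝ A)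
    (hs₀ : s₀ ∈ A) (hw : ∀ t, IsTrajectoryAt (X s₀) w t)
    (hφ : ContMDiff 𝓘(ℝ, Model m) 𝓘(ℝ, ℝ) ∞ φ) : ContDiff ℝ 1 fun t ↦ φ (w t) := by
  have hdiff : Differentiable ℝ fun t ↦ φ (w t) := fun t ↦
    ((hw t).hasDerivAt_flowDeriv hX hA hs₀ hφ 0).differentiableAt
  have hcont : Continuous w := continuous_iff_continuousAt.2 fun t ↦ (hw t).continuousAt
  refine contDiff_one_iff_deriv.2 ⟨hdiff, ?_⟩
  rw [hX.deriv_comp hA hs₀ hw hφ]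
  exact (hX.contMDiffOn_flowDeriv hA hφ 1).continuousOn.comp_continuous
    ((Continuous.prodMk_right s₀).prodMk hcont) fun _ ↦ ⟨⟨hs₀, mem_univ _⟩, mem_univ _⟩

theorem TendstoContinuously.deriv_comp {ι : Type*} {l : Filter ι} {s : ι → P} {u : ι → ℝ → M}
    (h : TendstoContinuously u w l) (hX : IsSmoothFieldOn X A) (hA : UniqueDiffOn ℝ A)
    (hsA : ∀ i, s i ∈ A) (hs : Tendsto s l (𝓝 s₀)) (hs₀ : s₀ ∈ A)
    (hu : ∀ i t, IsTrajectoryAt (X (s i)) (u i) t) (hw : ∀ t, IsTrajectoryAt (X s₀) w t)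
    (hφ : ContMDiff 𝓘(ℝ, Model m) 𝓘(ℝ, ℝ) ∞ φ) :
    TendstoContinuously (fun i ↦ deriv fun t ↦ φ (u i t)) (deriv fun t ↦ φ (w t)) l := by
  simp_rw [hX.deriv_comp hA hs₀ hw hφ, fun i ↦ hX.deriv_comp hA (hsA i) (hu i) hφ]
  exact h.comp_family (tendsto_nhdsWithin_iff.2 ⟨hs, Eventually.of_forall hsA⟩) hs₀
    (hX.contMDiffOn_flowDeriv hA hφ 1).continuousOn

end Smoothness

section MemLp

variable {b : ℝ → ℝ}

theorem memLp_Iic_of_comp_neg {p : ℝ≥0∞} (h : MemLp (fun t ↦ b (-t)) p (volume.restrict (Ici 0))) :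
    MemLp b p (volume.restrict (Iic 0)) := by
  have hneg := (Measure.measurePreserving_neg (volume : Measure ℝ)).restrict_preimage
    (measurableSet_Ici (a := (0 : ℝ)))
  simpa [Function.comp_def] using h.comp_measurePreserving hneg

theorem memLp_two_of_halves (hb : Continuous b) (hpos : MemLp b 2 (volume.restrict (Ici 0)))
    (hneg : MemLp (fun t ↦ b (-t)) 2 (volume.restrict (Ici 0))) : MemLp b 2 volume := by
  have hIic := memLp_Iic_of_comp_neg hneg
  rw [memLp_two_iff_integrable_sq hb.aestronglyMeasurable] at hpos hIic ⊢
  rw [← integrableOn_univ, ← Iic_union_Ici (a := (0 : ℝ))]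
  exact IntegrableOn.union hIic hpos

end MemLp

section Ends

variable {m : ℕ} {M : Type*} [TopologicalSpace M] [ChartedSpace (Model m) M]
  [IsManifold 𝓘(ℝ, Model m) ∞ M] {fα fβ : M → ℝ} {gα gβ : Metric m M} {T : ℝ} {p q : M}

/-- The curve `u` solves `u' = -∇_{gα} fα (u)` for `t < -T` and `u' = -∇_{gβ} fβ (u)` for `t > T`.
This is all that matters of a homotopy for the behaviour of its flow lines at the two ends. -/
structure FlowsAtEnds (gα : Metric m M) (fα : M → ℝ) (gβ : Metric m M) (fβ : M → ℝ) (T : ℝ)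
    (u : ℝ → M) : Prop where
  neg : ∀ t < -T, IsTrajectoryAt (fun _ x ↦ -gradient gα fα x) u t
  pos : ∀ t > T, IsTrajectoryAt (fun _ x ↦ -gradient gβ fβ x) u t

namespace FlowsAtEnds

theorem flowsAfter {u : ℝ → M} (hu : FlowsAtEnds gα fα gβ fβ T u) : FlowsAfter gβ fβ T u :=
  hu.pos

theorem flowsAfter_neg {u : ℝ → M} (hu : FlowsAtEnds gα fα gβ fβ T u) :
    FlowsAfter gα (-fα) T fun t ↦ u (-t) := fun _ ht ↦
  IsTrajectoryAt.reverse (hu.neg _ (neg_lt_neg ht))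

variable [CompactSpace M]

theorem memLp_deriv (hfα : ContMDiff 𝓘(ℝ, Model m) 𝓘(ℝ, ℝ) ∞ fα)
    (hfβ : ContMDiff 𝓘(ℝ, Model m) 𝓘(ℝ, ℝ) ∞ fβ) {u : ℝ → M}
    (hu : FlowsAtEnds gα fα gβ fβ T u) (huc : Continuous u) {φ : M → ℝ}
    (hφ : ContMDiff 𝓘(ℝ, Model m) 𝓘(ℝ, ℝ) ∞ φ) (hd : Continuous (deriv fun t ↦ φ (u t))) :
    MemLp (deriv fun t ↦ φ (u t)) 2 volume := by
  have hreverse : (deriv fun t ↦ φ (u (-t))) = fun t ↦ -deriv (fun t ↦ φ (u t)) (-t) :=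
    funext fun t ↦ deriv_comp_neg (fun t ↦ φ (u t)) t
  have hneg := hu.flowsAfter_neg.memLp_deriv (hfα.neg.mdifferentiable (by simp))
    (huc.comp continuous_neg) hφ (hreverse ▸ (hd.comp continuous_neg).neg)
  refine memLp_two_of_halves hd
    (hu.flowsAfter.memLp_deriv (hfβ.mdifferentiable (by simp)) huc hφ hd) ?_
  rw [hreverse] at hneg
  simpa [Pi.neg_def] using hneg.neg

theorem isW12Path (hfα : IsMorse m fα) (hfβ : IsMorse m fβ)
    (hp : IsCritical m fα p) (hq : IsCritical m fβ q) {u : ℝ → M}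
    (hu : FlowsAtEnds gα fα gβ fβ T u) (huc : Continuous u) (hbot : Tendsto u atBot (𝓝 p))
    (htop : Tendsto u atTop (𝓝 q)) (hsmooth : ∀ φ : M → ℝ,
      ContMDiff 𝓘(ℝ, Model m) 𝓘(ℝ, ℝ) ∞ φ → ContDiff ℝ 1 fun t ↦ φ (u t)) : IsW12Path m p q u where
  continuous := huc
  tendsto_atBot := hbot
  tendsto_atTop := htop
  weakDeriv φ hφ := by
    have hd := (hsmooth φ hφ).continuous_deriv le_rfl
    refine ⟨_, hu.memLp_deriv hfα.smooth hfβ.smooth huc hφ hd, fun a b ↦ ?_⟩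
    exact (intervalIntegral.integral_deriv_eq_sub
      (fun t _ ↦ (hsmooth φ hφ).differentiable one_ne_zero t) (hd.intervalIntegrable a b)).symm
  memLp_atBot φ hφ := memLp_Iic_of_comp_neg (b := fun t ↦ φ (u t) - φ p)
    (hu.flowsAfter_neg.memLp_sub hfα.neg (huc.comp continuous_neg) (isCritical_neg.2 hp)
      (hbot.comp tendsto_neg_atTop_atBot) hφ)
  memLp_atTop _ hφ := hu.flowsAfter.memLp_sub hfβ huc hq htop hφ

variable [RegularSpace M] {u : ℕ → ℝ → M} {w : ℝ → M} {φ : M → ℝ}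

theorem tendsto_eLpNorm_sub (hfα : IsMorse m fα) (hfβ : IsMorse m fβ)
    (hp : IsCritical m fα p) (hq : IsCritical m fβ q) (hu : ∀ ν, FlowsAtEnds gα fα gβ fβ T (u ν))
    (hup : ∀ ν, IsW12Path m p q (u ν)) (hw : FlowsAtEnds gα fα gβ fβ T w) (hwp : IsW12Path m p q w)
    (h : TendstoContinuously u w atTop) (hneg : StaysNear m (-fα) p fun ν t ↦ u ν (-t))
    (hpos : StaysNear m fβ q u) (hφ : ContMDiff 𝓘(ℝ, Model m) 𝓘(ℝ, ℝ) ∞ φ) :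
    Tendsto (fun ν ↦ eLpNorm (fun t ↦ φ (u ν t) - φ (w t)) 2 volume) atTop (𝓝 0) := by
  obtain ⟨V, hV, R, hR⟩ := hpos
  obtain ⟨V', hV', R', hR'⟩ := hneg
  refine tendsto_eLpNorm_two_of_halves ?_ ?_
  · exact FlowsAfter.tendsto_lintegral_sq_sub_comp hfβ hq (fun ν ↦ (hu ν).flowsAfter)
      (fun ν ↦ (hup ν).continuous) (fun ν ↦ (hup ν).tendsto_atTop) hw.flowsAfter
      hwp.tendsto_atTop h hV hR hφ
  · exact FlowsAfter.tendsto_lintegral_sq_sub_comp hfα.neg (isCritical_neg.2 hp)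
      (fun ν ↦ (hu ν).flowsAfter_neg) (fun ν ↦ (hup ν).continuous.comp continuous_neg)
      (fun ν ↦ (hup ν).tendsto_atBot.comp tendsto_neg_atTop_atBot) hw.flowsAfter_neg
      (hwp.tendsto_atBot.comp tendsto_neg_atTop_atBot) (h.precomp continuous_neg) hV' hR' hφ

theorem tendsto_eLpNorm_deriv_sub (hfα : ContMDiff 𝓘(ℝ, Model m) 𝓘(ℝ, ℝ) ∞ fα)
    (hfβ : ContMDiff 𝓘(ℝ, Model m) 𝓘(ℝ, ℝ) ∞ fβ) (hu : ∀ ν, FlowsAtEnds gα fα gβ fβ T (u ν))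
    (hup : ∀ ν, IsW12Path m p q (u ν)) (hw : FlowsAtEnds gα fα gβ fβ T w) (hwp : IsW12Path m p q w)
    (h : TendstoContinuously u w atTop) (hφ : ContMDiff 𝓘(ℝ, Model m) 𝓘(ℝ, ℝ) ∞ φ)
    (hd : TendstoContinuously (fun ν ↦ deriv fun t ↦ φ (u ν t)) (deriv fun t ↦ φ (w t)) atTop) :
    Tendsto (fun ν ↦ eLpNorm (fun t ↦ deriv (fun r ↦ φ (u ν r)) t - deriv (fun r ↦ φ (w r)) t)
      2 volume) atTop (𝓝 0) := by
  have hreverse : ∀ v : ℝ → M,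
      (deriv fun t ↦ φ (v (-t))) = fun t ↦ -deriv (fun t ↦ φ (v t)) (-t) :=
    fun v ↦ funext fun t ↦ deriv_comp_neg (fun t ↦ φ (v t)) t
  refine tendsto_eLpNorm_two_of_halves ?_ ?_
  · exact FlowsAfter.tendsto_lintegral_sq_sub_deriv hfβ (fun ν ↦ (hu ν).flowsAfter)
      (fun ν ↦ (hup ν).continuous) (fun ν ↦ (hup ν).tendsto_atTop) hw.flowsAfter
      hwp.tendsto_atTop h hφ hd
  · have hneg := FlowsAfter.tendsto_lintegral_sq_sub_deriv hfα.neg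
      (fun ν ↦ (hu ν).flowsAfter_neg) (fun ν ↦ (hup ν).continuous.comp continuous_neg)
      (fun ν ↦ (hup ν).tendsto_atBot.comp tendsto_neg_atTop_atBot) hw.flowsAfter_neg
      (hwp.tendsto_atBot.comp tendsto_neg_atTop_atBot) (h.precomp continuous_neg) hφ
      (by simpa only [hreverse] using (hd.precomp continuous_neg).postcomp continuous_neg)
    refine hneg.congr fun ν ↦ lintegral_congr fun t ↦ ?_
    rw [hreverse, hreverse]
    congr 1
    ring

end FlowsAtEnds

end Ends

section TwoSided

variable {m : ℕ} {M : Type*} [TopologicalSpace M] [ChartedSpace (Model m) M]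

theorem StaysNear.subseq {f : M → ℝ} {c : M} {u : ℕ → ℝ → M} (h : StaysNear m f c u) {j : ℕ → ℕ}
    (hj : StrictMono j) : StaysNear m f c fun ν ↦ u (j ν) := by
  obtain ⟨V, hV, R, hR⟩ := h
  exact ⟨V, hV, R, hj.tendsto_atTop.eventually hR⟩

variable [IsManifold 𝓘(ℝ, Model m) ∞ M] [T2Space M] [CompactSpace M] {fα fβ : M → ℝ}
  {gα gβ : Metric m M} {T : ℝ} {p q a b : M} {w : ℝ → M}

namespace FlowsAtEnds

theorem exists_tendsto (hfα : IsMorse m fα) (hfβ : IsMorse m fβ)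
    (hw : FlowsAtEnds gα fα gβ fβ T w) (hc : Continuous w) :
    (∃ a, IsCritical m fα a ∧ Tendsto w atBot (𝓝 a)) ∧
      ∃ b, IsCritical m fβ b ∧ Tendsto w atTop (𝓝 b) := by
  obtain ⟨a, ha, hlim⟩ := hw.flowsAfter_neg.exists_tendsto hfα.neg (hc.comp continuous_neg)
  refine ⟨⟨a, isCritical_neg.1 ha, ?_⟩, hw.flowsAfter.exists_tendsto hfβ hc⟩
  simpa [Function.comp_def] using hlim.comp tendsto_neg_atBot_atTop

theorem exists_subseq_chains (hfα : IsMorse m fα) (hfβ : IsMorse m fβ) (hp : IsCritical m fα p)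
    (hq : IsCritical m fβ q) {E : Type*} [MetricSpace E] {e : M → E} (he : IsInducing e)
    {K : NNReal} {u : ℕ → ℝ → M} (hLip : ∀ ν, LipschitzWith K fun t ↦ e (u ν t))
    (hu : ∀ ν, FlowsAtEnds gα fα gβ fβ T (u ν)) (hup : ∀ ν, IsW12Path m p q (u ν))
    (h : TendstoContinuously u w atTop) (ha : IsCritical m fα a) (hb : IsCritical m fβ b)
    (hbot : Tendsto w atBot (𝓝 a)) (htop : Tendsto w atTop (𝓝 b)) :
    ∃ j : ℕ → ℕ, StrictMono j ∧
      (∃ C : Chain gα fα (fun ν ↦ u (j ν)) atBot p a,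
        C.length = 0 → StaysNear m (-fα) p fun ν t ↦ u (j ν) (-t)) ∧
      ∃ C : Chain gβ fβ (fun ν ↦ u (j ν)) atTop b q,
        C.length = 0 → StaysNear m fβ q fun ν ↦ u (j ν) := by
  obtain ⟨i, hi, right, hright⟩ := exists_chain hfβ he hLip (fun ν ↦ (hu ν).flowsAfter) hq
    (fun ν ↦ (hup ν).tendsto_atTop) (r := fun _ ↦ 0) (Eventually.of_forall fun _ ↦ le_rfl)
    (by simpa using h) hb htop
  obtain ⟨k, hk, left, hleft⟩ := exists_chain hfα.neg he (u := fun ν t ↦ u (i ν) (-t))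
    (w := fun t ↦ w (-t))
    (fun ν x y ↦ by simpa using hLip (i ν) (-x) (-y)) (fun ν ↦ (hu (i ν)).flowsAfter_neg)
    (isCritical_neg.2 hp) (fun ν ↦ (hup (i ν)).tendsto_atBot.comp tendsto_neg_atTop_atBot)
    (r := fun _ ↦ 0) (Eventually.of_forall fun _ ↦ le_rfl)
    (by simpa using (h.comp_index hi.tendsto_atTop).precomp continuous_neg)
    (isCritical_neg.2 ha) (hbot.comp tendsto_neg_atTop_atBot)
  simp only [add_zero] at hright hleft
  exact ⟨fun ν ↦ i (k ν), hi.comp hk, ⟨left.reverse, hleft⟩, right.subseq hk,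
    fun h ↦ (hright h).subseq hk⟩

end FlowsAtEnds

end TwoSided

section Homotopy

variable {m ℓ : ℕ} {M : Type*} [TopologicalSpace M] [ChartedSpace (Model m) M]

theorem uniqueDiffOn_cube (ℓ : ℕ) : UniqueDiffOn ℝ (cube ℓ) := by
  rw [cube, ← pi_univ_Icc]
  exact UniqueDiffOn.univ_pi fun _ ↦ uniqueDiffOn_Icc zero_lt_one

variable [IsManifold 𝓘(ℝ, Model m) ∞ M]

variable (m M) in
theorem exists_isInducing_pi [T2Space M] [CompactSpace M] : ∃ (n : ℕ) (e : M → Fin n → ℝ),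
    IsInducing e ∧ ∀ i, ContMDiff 𝓘(ℝ, Model m) 𝓘(ℝ, ℝ) ∞ fun x ↦ e x i := by
  obtain ⟨n, e, he, hemb, -⟩ := exists_embedding_euclidean_of_compact (M := M) (I := 𝓘(ℝ, Model m))
  exact ⟨n, fun x ↦ WithLp.ofLp (e x),
    (PiLp.homeomorph 2 fun _ : Fin n ↦ ℝ).isInducing.comp hemb.isInducing,
    fun i ↦ (EuclideanSpace.proj (𝕜 := ℝ) i).contMDiff.comp he⟩

variable {fα fβ : M → ℝ} {gα gβ : Metric m M} {H : (Fin ℓ → ℝ) → ℝ → M → ℝ}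
  {G : (Fin ℓ → ℝ) → ℝ → Metric m M} {φ : M → ℝ} {s₀ : Fin ℓ → ℝ} {w : ℝ → M} {p q : M}

namespace IsHomotopy

theorem isSmoothFieldOn (hHG : IsHomotopy fα gα fβ gβ H G) :
    IsSmoothFieldOn (fun s t x ↦ -gradient (G s t) (H s t) x) (cube ℓ) :=
  isSmoothFieldOn_neg_gradient hHG.smooth_fun hHG.smooth_metric

theorem exists_flowsAtEnds (hHG : IsHomotopy fα gα fβ gβ H G) :
    ∃ T, ∀ s ∈ cube ℓ, ∀ u, IsFlowLine (G s) (H s) u → FlowsAtEnds gα fα gβ fβ T u := by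
  obtain ⟨T, -, hT⟩ := hHG.finite
  refine ⟨T, fun s hs u hu ↦ ⟨fun t ht ↦ ?_, fun t ht ↦ ?_⟩⟩
  · obtain ⟨hH, hG⟩ := (hT s hs).1 t ht
    exact hG ▸ hH ▸ hu t
  · obtain ⟨hH, hG⟩ := (hT s hs).2 t ht
    exact hG ▸ hH ▸ hu t

theorem exists_compact_times (hHG : IsHomotopy fα gα fβ gβ H G) :
    ∃ R, ∀ s ∈ cube ℓ, ∀ t, ∃ t' ∈ Icc (-R) R, H s t = H s t' ∧ G s t = G s t' := by
  obtain ⟨T, hT, hends⟩ := hHG.finite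
  refine ⟨T + 1, fun s hs t ↦ ?_⟩
  rcases lt_or_ge t (-(T + 1)) with hneg | hneg
  · obtain ⟨hH, hG⟩ := (hends s hs).1 t (by linarith)
    obtain ⟨hH', hG'⟩ := (hends s hs).1 (-(T + 1)) (by linarith)
    exact ⟨-(T + 1), ⟨le_rfl, by linarith⟩, hH.trans hH'.symm, hG.trans hG'.symm⟩
  rcases lt_or_ge (T + 1) t with hpos | hpos
  · obtain ⟨hH, hG⟩ := (hends s hs).2 t (by linarith)
    obtain ⟨hH', hG'⟩ := (hends s hs).2 (T + 1) (by linarith)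
    exact ⟨T + 1, ⟨by linarith, le_rfl⟩, hH.trans hH'.symm, hG.trans hG'.symm⟩
  · exact ⟨t, ⟨hneg, hpos⟩, rfl, rfl⟩

theorem exists_bound_flowDeriv [CompactSpace M] (hHG : IsHomotopy fα gα fβ gβ H G)
    (hφ : ContMDiff 𝓘(ℝ, Model m) 𝓘(ℝ, ℝ) ∞ φ) : ∃ C : NNReal, ∀ s ∈ cube ℓ, ∀ t x,
      ‖flowDeriv (fun s t x ↦ -gradient (G s t) (H s t) x) (cube ℓ) φ 1 ((s, t), x)‖ ≤ C := by
  obtain ⟨R, hR⟩ := hHG.exists_compact_times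
  have hcompact : IsCompact ((cube ℓ ×ˢ Icc (-R) R) ×ˢ (univ : Set M)) :=
    (isCompact_Icc.prod isCompact_Icc).prod isCompact_univ
  obtain ⟨C, hC⟩ := hcompact.exists_bound_of_continuousOn
    ((hHG.isSmoothFieldOn.contMDiffOn_flowDeriv (uniqueDiffOn_cube ℓ) hφ 1).continuousOn.mono
      (prod_mono_left (prod_mono_right (subset_univ _))))
  refine ⟨C.toNNReal, fun s hs t x ↦ ?_⟩
  obtain ⟨t', ht', hH, hG⟩ := hR s hs t
  have hbound := hC ((s, t'), x) ⟨⟨hs, ht'⟩, mem_univ _⟩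
  rw [flowDeriv_one (uniqueDiffOn_cube ℓ) (hφ.mdifferentiable (by simp)) hs] at hbound ⊢
  simp only [hH, hG]
  exact hbound.trans (Real.le_coe_toNNReal C)

theorem exists_lipschitzWith [CompactSpace M] (hHG : IsHomotopy fα gα fβ gβ H G)
    {ι : Type*} [Fintype ι] {e : M → ι → ℝ}
    (he : ∀ i, ContMDiff 𝓘(ℝ, Model m) 𝓘(ℝ, ℝ) ∞ fun x ↦ e x i) :
    ∃ K : NNReal, ∀ s ∈ cube ℓ, ∀ u, IsFlowLine (G s) (H s) u →
      LipschitzWith K fun t ↦ e (u t) := by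
  choose C hC using fun i ↦ hHG.exists_bound_flowDeriv (he i)
  refine ⟨Finset.univ.sup C, fun s hs u hu ↦ ?_⟩
  have hcoord : ∀ i, LipschitzWith (C i) fun t ↦ e (u t) i := fun i ↦ by
    have htraj : ∀ t, IsTrajectoryAt (fun t x ↦ -gradient (G s t) (H s t) x) u t := hu
    have hderiv : ∀ t, HasDerivAt (fun τ ↦ e (u τ) i) _ t := fun t ↦
      (htraj t).hasDerivAt_flowDeriv hHG.isSmoothFieldOn (uniqueDiffOn_cube ℓ) hs (he i) 0
    refine lipschitzWith_of_nnnorm_deriv_le (fun t ↦ (hderiv t).differentiableAt) fun t ↦ ?_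
    rw [(hderiv t).deriv]
    exact hC i s hs t (u t)
  refine fun x y ↦ edist_pi_le_iff.2 fun i ↦ (hcoord i x y).trans ?_
  gcongr
  exact Finset.le_sup (Finset.mem_univ i)

theorem isW12Path [CompactSpace M] (hHG : IsHomotopy fα gα fβ gβ H G)
    (hfα : IsMorse m fα) (hfβ : IsMorse m fβ) (hp : IsCritical m fα p) (hq : IsCritical m fβ q)
    (hs₀ : s₀ ∈ cube ℓ) (hw : IsFlowLine (G s₀) (H s₀) w) (hbot : Tendsto w atBot (𝓝 p))
    (htop : Tendsto w atTop (𝓝 q)) : IsW12Path m p q w := by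
  obtain ⟨T, hT⟩ := hHG.exists_flowsAtEnds
  exact (hT s₀ hs₀ w hw).isW12Path hfα hfβ hp hq hw.continuous hbot htop fun φ hφ ↦
    hHG.isSmoothFieldOn.contDiff_comp (uniqueDiffOn_cube ℓ) hs₀ hw hφ

variable [T2Space M] [CompactSpace M] {z : ℕ → (Fin ℓ → ℝ) × (ℝ → M)}

theorem exists_subseq_tendstoContinuously (hHG : IsHomotopy fα gα fβ gβ H G) {E : Type*}
    [MetricSpace E] {e : M → E} (he : IsInducing e) {K : NNReal} (hz : ∀ ν, z ν ∈ moduli H G p q)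
    (hLip : ∀ ν, LipschitzWith K fun t ↦ e ((z ν).2 t)) :
    ∃ j : ℕ → ℕ, StrictMono j ∧ ∃ s₀ ∈ cube ℓ, ∃ w, IsFlowLine (G s₀) (H s₀) w ∧
      Tendsto (fun ν ↦ (z (j ν)).1) atTop (𝓝 s₀) ∧
      TendstoContinuously (fun ν ↦ (z (j ν)).2) w atTop := by
  obtain ⟨s₀, hs₀, i, hi, hs⟩ := isCompact_Icc.tendsto_subseq fun ν ↦ (hz ν).1
  obtain ⟨k, hk, w, hw⟩ :=
    HigherMorse.exists_subseq_tendstoContinuously he fun ν ↦ hLip (i ν)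
  have hs' := hs.comp hk.tendsto_atTop
  refine ⟨fun ν ↦ i (k ν), hi.comp hk, s₀, hs₀, w, fun t ↦ ?_, hs', hw⟩
  exact hw.isTrajectoryAt hHG.isSmoothFieldOn (uniqueDiffOn_cube ℓ)
    (tendsto_nhdsWithin_iff.2 ⟨hs', Eventually.of_forall fun _ ↦ (hz _).1⟩) hs₀
    (Eventually.of_forall fun _ ↦ (hz _).2.2 _)

theorem exists_subseq_limit_and_chains (hHG : IsHomotopy fα gα fβ gβ H G) (hfα : IsMorse m fα)
    (hfβ : IsMorse m fβ) (hp : IsCritical m fα p) (hq : IsCritical m fβ q)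
    (hz : ∀ ν, z ν ∈ moduli H G p q) :
    ∃ j : ℕ → ℕ, StrictMono j ∧ ∃ s₀ w a b, (s₀, w) ∈ moduli H G a b ∧
      Tendsto (fun ν ↦ (z (j ν)).1) atTop (𝓝 s₀) ∧
      TendstoContinuously (fun ν ↦ (z (j ν)).2) w atTop ∧
      (∃ C : Chain gα fα (fun ν ↦ (z (j ν)).2) atBot p a,
        C.length = 0 → StaysNear m (-fα) p fun ν t ↦ (z (j ν)).2 (-t)) ∧
      ∃ C : Chain gβ fβ (fun ν ↦ (z (j ν)).2) atTop b q,
        C.length = 0 → StaysNear m fβ q fun ν ↦ (z (j ν)).2 := by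
  obtain ⟨n, e, he, hsmooth⟩ := exists_isInducing_pi m M
  obtain ⟨K, hK⟩ := hHG.exists_lipschitzWith hsmooth
  obtain ⟨T, hT⟩ := hHG.exists_flowsAtEnds
  have hLip := fun ν ↦ hK _ (hz ν).1 _ (hz ν).2.2
  have hends := fun ν ↦ hT _ (hz ν).1 _ (hz ν).2.2
  obtain ⟨i, hi, s₀, hs₀, w, hw, hs, hlim⟩ := hHG.exists_subseq_tendstoContinuously he hz hLip
  obtain ⟨⟨a, ha, hbot⟩, b, hb, htop⟩ := (hT s₀ hs₀ w hw).exists_tendsto hfα hfβ hw.continuous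
  obtain ⟨k, hk, hchains⟩ := FlowsAtEnds.exists_subseq_chains hfα hfβ hp hq he
    (fun ν ↦ hLip (i ν)) (fun ν ↦ hends (i ν)) (fun ν ↦ (hz (i ν)).2.1) hlim ha hb hbot htop
  have hmem : (s₀, w) ∈ moduli H G a b :=
    ⟨hs₀, hHG.isW12Path hfα hfβ ha hb hs₀ hw hbot htop, hw⟩
  exact ⟨fun ν ↦ i (k ν), hi.comp hk, s₀, w, a, b, hmem, hs.comp hk.tendsto_atTop,
    hlim.comp_index hk.tendsto_atTop, hchains⟩

theorem tendstoCinftyLoc (hHG : IsHomotopy fα gα fβ gβ H G) (hz : ∀ ν, z ν ∈ moduli H G p q)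
    (hs₀ : s₀ ∈ cube ℓ) (hs : Tendsto (fun ν ↦ (z ν).1) atTop (𝓝 s₀))
    (h : TendstoContinuously (fun ν ↦ (z ν).2) w atTop) :
    TendstoCinftyLoc m (fun ν ↦ (z ν).2) w :=
  h.tendstoCinftyLoc hHG.isSmoothFieldOn (uniqueDiffOn_cube ℓ)
    (tendsto_nhdsWithin_iff.2 ⟨hs, Eventually.of_forall fun ν ↦ (hz ν).1⟩) hs₀
    fun _ ↦ Eventually.of_forall fun y ↦ (hz y.1).2.2 y.2

theorem convergesInModuli (hHG : IsHomotopy fα gα fβ gβ H G) (hfα : IsMorse m fα)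
    (hfβ : IsMorse m fβ) (hp : IsCritical m fα p) (hq : IsCritical m fβ q)
    (hz : ∀ ν, z ν ∈ moduli H G p q) (hw : (s₀, w) ∈ moduli H G p q)
    (hs : Tendsto (fun ν ↦ (z ν).1) atTop (𝓝 s₀))
    (h : TendstoContinuously (fun ν ↦ (z ν).2) w atTop)
    (hneg : StaysNear m (-fα) p fun ν t ↦ (z ν).2 (-t))
    (hpos : StaysNear m fβ q fun ν ↦ (z ν).2) : ConvergesInModuli H G p q z := by
  obtain ⟨T, hT⟩ := hHG.exists_flowsAtEnds
  have hends := fun ν ↦ hT _ (hz ν).1 _ (hz ν).2.2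
  have hends₀ := hT s₀ hw.1 w hw.2.2
  refine ⟨(s₀, w), hw, hs, fun φ hφ ↦ ⟨?_, ?_⟩⟩
  · exact FlowsAtEnds.tendsto_eLpNorm_sub hfα hfβ hp hq hends (fun ν ↦ (hz ν).2.1) hends₀ hw.2.1 h
      hneg hpos hφ
  · exact FlowsAtEnds.tendsto_eLpNorm_deriv_sub hfα.smooth hfβ.smooth hends (fun ν ↦ (hz ν).2.1)
      hends₀ hw.2.1 h hφ (h.deriv_comp hHG.isSmoothFieldOn (uniqueDiffOn_cube ℓ)
        (fun ν ↦ (hz ν).1) hs hw.1 (fun ν ↦ (hz ν).2.2) hw.2.2 hφ)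

end IsHomotopy

end Homotopy

section Pieces

variable {m : ℕ} {M : Type*} [TopologicalSpace M] [ChartedSpace (Model m) M]
  [IsManifold 𝓘(ℝ, Model m) ∞ M] [CompactSpace M] {f : M → ℝ} {g : Metric m M}
  {u : ℕ → ℝ → M} {l : Filter ℝ} {a b : M} {w : ℝ → M} {r : ℕ → ℝ}

theorem Chain.curve_mem_connectingAutonomous {c q : M} (C : Chain g f u l c q) (hf : IsMorse m f)
    {k : ℕ} (hk : k < C.length) :
    C.curve k ∈ connectingAutonomous g f (C.point k) (C.point (k + 1)) := by
  obtain ⟨hflow, hbot, htop, -, -, -⟩ := C.isShiftLimit k hk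
  have hends : FlowsAtEnds g f g f 0 (C.curve k) := ⟨fun t _ ↦ hflow t, fun t _ ↦ hflow t⟩
  exact ⟨hends.isW12Path hf hf (C.isCritical k hk.le) (C.isCritical _ hk) hflow.continuous hbot htop
    fun φ hφ ↦ (isSmoothFieldOn_const_neg_gradient g hf.smooth).contDiff_comp (s₀ := 0)
      uniqueDiffOn_univ (mem_univ _) hflow hφ, hflow⟩

variable [T2Space M]

theorem IsShiftLimit.tendstoCinftyLoc (h : IsShiftLimit g f u l a b w r)
    (hf : ContMDiff 𝓘(ℝ, Model m) 𝓘(ℝ, ℝ) ∞ f)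
    (hu : ∀ᶠ τ in l, ∀ ν, IsTrajectoryAt (fun _ x ↦ -gradient g f x) (u ν) τ) :
    TendstoCinftyLoc m (fun ν t ↦ u ν (t + r ν)) w :=
  h.tendstoContinuously.tendstoCinftyLoc (s := fun _ ↦ 0) (isSmoothFieldOn_const_neg_gradient g hf)
    uniqueDiffOn_univ (tendsto_const_nhds.mono_right (nhdsWithin_univ _).ge) (mem_univ _)
    fun t ↦ ((h.tendsto_shift t).eventually hu).mono fun y hy ↦ (hy y.1).comp_add

end Pieces

section Assembly

variable {m ℓ : ℕ} {M : Type*} [TopologicalSpace M] [ChartedSpace (Model m) M]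
  [IsManifold 𝓘(ℝ, Model m) ∞ M] [CompactSpace M] {fα fβ : M → ℝ}
  {gα gβ : Metric m M} {H : (Fin ℓ → ℝ) → ℝ → M → ℝ} {G : (Fin ℓ → ℝ) → ℝ → Metric m M}
  {u : ℕ → ℝ → M} {s₀ : Fin ℓ → ℝ} {w : ℝ → M} {p q a b : M}

/-- The broken line made of the curves of `left`, the curve `w` and the curves of `right`, in this
order; the middle piece is therefore number `left.length`. -/
def brokenLine (hfα : IsMorse m fα) (hfβ : IsMorse m fβ) (hw : (s₀, w) ∈ moduli H G a b)
    (left : Chain gα fα u atBot p a) (right : Chain gβ fβ u atTop b q)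
    (hlength : 0 < left.length + right.length) : BrokenLine fα gα fβ gβ H G p q where
  n := left.length + 1 + right.length
  two_le := by omega
  k₀ := ⟨left.length, by omega⟩
  s₀ := s₀
  u k := if k.val < left.length then left.curve k else
    if k.val = left.length then w else right.curve (k - left.length - 1)
  c i := if i.val ≤ left.length then left.point i else right.point (i - left.length - 1)
  c_zero := by simp [left.point_zero]
  c_last := by
    have hlast : left.length + 1 + right.length - left.length - 1 = right.length := by omega
    rw [Fin.val_last, if_neg (by omega), hlast, right.point_length]
  critical_left i hi := by
    have hle : i.val ≤ left.length := hi
    rw [if_pos hle]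
    exact left.isCritical i hle
  critical_right i hi := by
    have hlt : left.length < i.val := hi
    rw [if_neg hlt.not_ge]
    exact right.isCritical _ (by omega)
  mem_left k hk := by
    have hlt : k.val < left.length := hk
    simpa only [Fin.val_castSucc, Fin.val_succ, if_pos hlt, if_pos hlt.le,
      if_pos (Nat.succ_le_of_lt hlt)] using left.curve_mem_connectingAutonomous hfα hlt
  mem_middle := by simpa [left.point_length, right.point_zero] using hw
  mem_right k hk := by
    have hgt : left.length < k.val := hk
    have hsucc : k.val + 1 - left.length - 1 = k.val - left.length - 1 + 1 := by omega
    simp only [Fin.val_castSucc, Fin.val_succ, if_neg hgt.not_ge, if_neg hgt.ne', if_neg hgt.not_gt,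
      if_neg (hgt.trans k.val.lt_succ_self).not_ge, hsucc]
    exact right.curve_mem_connectingAutonomous hfβ (by omega)
  nonconstant k hk := by
    rcases lt_or_gt_of_ne (Fin.val_ne_of_ne hk) with hlt | hgt
    · rw [if_pos hlt]
      exact (left.isShiftLimit k hlt).nonconstant
    · rw [if_neg hgt.not_gt, if_neg hgt.ne']
      exact (right.isShiftLimit _ (by lia)).nonconstant

theorem floerGromovTendsto_brokenLine [T2Space M] {T : ℝ} {z : ℕ → (Fin ℓ → ℝ) × (ℝ → M)}
    (hfα : IsMorse m fα) (hfβ : IsMorse m fβ)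
    (hends : ∀ ν, FlowsAtEnds gα fα gβ fβ T (z ν).2) (hw : (s₀, w) ∈ moduli H G a b)
    (hs : Tendsto (fun ν ↦ (z ν).1) atTop (𝓝 s₀)) (hz : TendstoCinftyLoc m (fun ν ↦ (z ν).2) w)
    (left : Chain gα fα (fun ν ↦ (z ν).2) atBot p a)
    (right : Chain gβ fβ (fun ν ↦ (z ν).2) atTop b q)
    (hlength : 0 < left.length + right.length) :
    FloerGromovTendsto z (brokenLine hfα hfβ hw left right hlength) := by
  refine ⟨hs, fun k ν ↦ if k.val < left.length then left.shift k ν else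
    if k.val = left.length then 0 else right.shift (k - left.length - 1) ν,
    fun ν ↦ by simp [brokenLine], fun k ↦ ?_⟩
  have hk : k.val < left.length + 1 + right.length := k.2
  simp only [brokenLine]
  rcases lt_trichotomy k.val left.length with hlt | heq | hgt
  · simp only [if_pos hlt]
    exact (left.isShiftLimit k hlt).tendstoCinftyLoc hfα.smooth
      ((eventually_lt_atBot (-T)).mono fun t ht ν ↦ (hends ν).neg t ht)
  · simpa only [heq, lt_irrefl, if_true, if_false, add_zero] using hz
  · simp only [if_neg hgt.not_gt, if_neg hgt.ne']
    exact (right.isShiftLimit _ (by omega)).tendstoCinftyLoc hfβ.smooth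
      ((eventually_gt_atTop T).mono fun t ht ν ↦ (hends ν).pos t ht)

end Assembly

end HigherMorse

theorem mainTheorem3 {m ℓ : ℕ} {M : Type*} [TopologicalSpace M] [T2Space M] [CompactSpace M]
    [ChartedSpace (HigherMorse.Model m) M]
    [IsManifold (modelWithCornersSelf ℝ (HigherMorse.Model m)) ∞ M]
    (fα fβ : M → ℝ) (gα gβ : HigherMorse.Metric m M)
    (hfα : HigherMorse.IsMorse m fα) (hfβ : HigherMorse.IsMorse m fβ)
    (H : (Fin ℓ → ℝ) → ℝ → M → ℝ) (G : (Fin ℓ → ℝ) → ℝ → HigherMorse.Metric m M)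
    (hHG : HigherMorse.IsHomotopy fα gα fβ gβ H G)
    (p q : M) (hp : HigherMorse.IsCritical m fα p) (hq : HigherMorse.IsCritical m fβ q)
    (z : ℕ → (Fin ℓ → ℝ) × (ℝ → M)) (hz : ∀ ν, z ν ∈ HigherMorse.moduli H G p q) :
    ∃ j : ℕ → ℕ, StrictMono j ∧
      (¬ HigherMorse.ConvergesInModuli H G p q (z ∘ j) →
        ∃ y : HigherMorse.BrokenLine fα gα fβ gβ H G p q,
          HigherMorse.FloerGromovTendsto (z ∘ j) y) := by
  obtain ⟨j, hj, s₀, w, a, b, hw, hs, hlim, ⟨left, hleft⟩, right, hright⟩ :=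
    hHG.exists_subseq_limit_and_chains hfα hfβ hp hq hz
  refine ⟨j, hj, fun hnot ↦ ?_⟩
  rcases Nat.eq_zero_or_pos (left.length + right.length) with hzero | hpos
  · obtain ⟨hl, hr⟩ := Nat.add_eq_zero_iff.1 hzero
    obtain rfl := left.eq_of_length_eq_zero hl
    obtain rfl := right.eq_of_length_eq_zero hr
    exact absurd (hHG.convergesInModuli hfα hfβ hp hq (fun ν ↦ hz (j ν)) hw hs hlim (hleft hl)
      (hright hr)) hnot
  · obtain ⟨T, hT⟩ := hHG.exists_flowsAtEnds
    have hends := fun ν ↦ hT _ (hz (j ν)).1 _ (hz (j ν)).2.2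
    have hsmooth := hHG.tendstoCinftyLoc (fun ν ↦ hz (j ν)) hw.1 hs hlim
    exact ⟨_, HigherMorse.floerGromovTendsto_brokenLine hfα hfβ hends hw hs hsmooth left right hpos⟩
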